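/- Let $\mathcal X_1,\mathcal X_2,\mathcal Y$ be finite alphabets, let $P_{Y|X_1,X_2}$ be the transition probability of a memoryless channel, let $d_{\min},d_{\max}\ge 0$ be integers, $\mathcal D=\{-d_{\min},\dots,d_{\max}\}$ and $D=|\mathcal D|=d_{\min}+d_{\max}+1$. The asynchronous cognitive multiple access channel (ACMAC) with block length $n$ and delay $d\in\mathcal D$ is $$P_d(\mathbf y\mid\mathbf x_1,\mathbf x_2)=\prod_{i=1}^n P_{Y|X_1,X_2}(y_i\mid x_{1,i-d},x_{2,i}),$$ where the edge symbols $x_{1,j}$ with $j\notin\{1,\dots,n\}$ are arbitrary: for all $n$ and $d$ a nonempty set $\mathcal E_{n,d}$ of admissible assignments $b$ of edge symbols is given (a single assignment, all assignments, or anything in between), and we write $P_{d,b}$ for $P_d$ with the edge symbols given by $b$. A code of block length $n$ for nonnegative rates $(R_1,R_2)$ consists of message sets $\mathcal M_k$ of size $\lceil 2^{nR_k}\rceil$, deterministic encoders $f_1:\mathcal M_1\to\mathcal X_1^n$ and $f_2:\mathcal M_1\times\mathcal M_2\to\mathcal X_2^n$, and a decoder $g:\mathcal Y^n\to\mathcal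 M_1\times\mathcal M_2$, none of which knows the delay. A pair $(R_1,R_2)$ of nonnegative reals is achievable if there are $\epsilon_n\to0$ and, for each $n$, a code of block length $n$ for these rates whose average probability of error (over uniform independent messages) under $P_{d,b}$ is at most $\epsilon_n$ for all $d\in\mathcal D$ and $b\in\mathcal E_{n,d}$. The capacity region $\mathcal C$ is the closure of the set of achievable pairs. For a pmf $P(\mathbf x_1,\mathbf x_2)$ on $\mathcal X_1^n\times\mathcal X_2^n$, let $I_{d,b}$ be mutual information (in bits) under $P(\mathbf x_1,\mathbf x_2)P_{d,b}(\mathbf y\mid\mathbf x_1,\mathbf x_2)$, and let $I_d$ be mutual information under $P(\mathbf x_1,\mathbf x_2)\prod_{i=d_{\max}+1}^{n-d_{\min}}P_{Y|X_1,X_2}(y_i\mid x_{1,i-d},x_{2,i})$, which involves no edge symbols. Let $$\mathcal R_n=\bigcup_{P(\mathbf x_1,\mathbf x_2)}\bigcap_{d\in\mathcal D}\bigcap_{b\in\mathcal E_{n,d}}\Big\{(R_1,R_2)\in\mathbb R_{\ge0}^2:\ R_1+R_2\le\tfrac1n I_{d,b}(\mathbf X_1,\mathbf X_2;\mathbf Y),\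 R_2\le\tfrac1n I_{d,b}(\mathbf X_2;\mathbf Y\mid\mathbf X_1)\Big\},$$ $$\mathcal Q_n=\bigcup_{P(\mathbf x_1,\mathbf x_2)}\bigcap_{d\in\mathcal D}\Big\{(R_1,R_2)\in\mathbb R_{\ge0}^2:\ R_1+R_2\le\tfrac1n I_d(\mathbf X_1,\mathbf X_2;Y_{d_{\max}+1}^{n-d_{\min}}),\ R_2\le\tfrac1n I_d(\mathbf X_2;Y_{d_{\max}+1}^{n-d_{\min}}\mid\mathbf X_1)\Big\}.$$ Then, for every choice of the sets $\mathcal E_{n,d}$, $$\mathcal C=\operatorname{closure}\Big(\bigcup_{n\ge D}\mathcal Q_n\Big)=\operatorname{closure}\Big(\limsup_{n\to\infty}\mathcal R_n\Big)=\operatorname{closure}\Big(\liminf_{n\to\infty}\mathcal R_n\Big),$$ where $\limsup_n\mathcal R_n=\bigcap_{m}\bigcup_{n\ge m}\mathcal R_n$ and $\liminf_n\mathcal R_n=\bigcup_m\bigcap_{n\ge m}\mathcal R_n$. -/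

import Mathlib

open Filter Topology

noncomputable section

namespace ACMAC

/-! ### Information measures of finite-alphabet laws, in bits -/

section Information

variable {A B C : Type*} [Fintype A] [Fintype B] [Fintype C]

/-- The mutual information `I(A;B)` in bits of a joint pmf `p a b` on finite alphabets:
`∑ p(a,b) log₂ (p(a,b) / (p(a) p(b)))`. A term with `p(a,b) = 0` contributes `0`. -/
def mutualInfo (p : A → B → ℝ) : ℝ :=
  ∑ a, ∑ b, p a b * Real.logb 2 (p a b / ((∑ b', p a b') * (∑ a', p a' b)))

/-- The conditional mutual information `I(A;B|C)` in bits of a joint pmf `p a b c` on finite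
alphabets: `∑ p(a,b,c) log₂ (p(a,b,c) p(c) / (p(a,c) p(b,c)))`. A term with `p(a,b,c) = 0`
contributes `0`. -/
def condMutualInfo (p : A → B → C → ℝ) : ℝ :=
  ∑ a, ∑ b, ∑ c, p a b c *
    Real.logb 2 (p a b c * (∑ a', ∑ b', p a' b' c) / ((∑ b', p a b' c) * (∑ a', p a' b c)))

end Information

/-! ### The channel -/

/-- The delay set `{-dmin, …, dmax}`. -/
abbrev Delay (dmin dmax : ℕ) : Type :=
  ↥(Finset.Icc (-(dmin : ℤ)) (dmax : ℤ))

section Channel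

variable {X₁ X₂ Y : Type*}

/-- The word `x`, at the time instants `0, …, n - 1`, continued outside this range by the edge
symbols `b`. (Time starts at `0` here; the values of `b` at `0, …, n - 1` are irrelevant.) -/
def extend {n : ℕ} (b : ℤ → X₁) (x : Fin n → X₁) (j : ℤ) : X₁ :=
  if h : 0 ≤ j ∧ j < n then x ⟨j.toNat, by omega⟩ else b j

/-- `P_d(y | x₁, x₂) = ∏ i, W(y i | x₁ (i - d), x₂ i)`, where `x₁ (i - d)` is the edge symbol
`b (i - d)` whenever `i - d` is not one of the instants of the block. -/
def law (W : X₁ → X₂ → Y → ℝ) {n : ℕ} (d : ℤ) (b : ℤ → X₁)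
    (x₁ : Fin n → X₁) (x₂ : Fin n → X₂) (y : Fin n → Y) : ℝ :=
  ∏ i : Fin n, W (extend b x₁ ((i : ℤ) - d)) (x₂ i) (y i)

/-- The instants of a block of length `n` that remain when the first `dmax` and the last `dmin`
of them are discarded. -/
abbrev Core (dmin dmax n : ℕ) : Type :=
  {i : Fin n // dmax ≤ (i : ℕ) ∧ (i : ℕ) + dmin < n}

/-- For an instant `i` of the core and a delay `d`, the instant `i - d` lies in the block. -/
def shift {dmin dmax n : ℕ} (d : Delay dmin dmax) (i : Core dmin dmax n) : Fin n :=
  ⟨((i.1 : ℤ) - d.1).toNat, by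
    have h1 := Finset.mem_Icc.mp d.2
    have h2 := i.2
    omega⟩

/-- The law of the outputs at the core instants, given the two input words:
`∏ i, W(y i | x₁ (i - d), x₂ i)` over the core instants `i`. -/
def coreLaw (W : X₁ → X₂ → Y → ℝ) {dmin dmax n : ℕ} (d : Delay dmin dmax)
    (x₁ : Fin n → X₁) (x₂ : Fin n → X₂) (y : Core dmin dmax n → Y) : ℝ :=
  ∏ i : Core dmin dmax n, W (x₁ (shift d i)) (x₂ i.1) (y i)

end Channel

/-! ### Codes and the capacity region -/

/-- A code with `M₁` and `M₂` messages and block length `n`. The second encoder knows both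
messages; neither the encoders nor the decoder know the delay. -/
structure Code (X₁ X₂ Y : Type*) (M₁ M₂ n : ℕ) where
  enc₁ : Fin M₁ → Fin n → X₁
  enc₂ : Fin M₁ → Fin M₂ → Fin n → X₂
  dec : (Fin n → Y) → Fin M₁ × Fin M₂

section Capacity

variable {X₁ X₂ Y : Type*} [Fintype X₁] [Fintype X₂] [Fintype Y]

/-- The average probability of error of a code for the delay `d` and the edge symbols `b`. -/
def errorProb (W : X₁ → X₂ → Y → ℝ) {M₁ M₂ n : ℕ} (c : Code X₁ X₂ Y M₁ M₂ n)
    (d : ℤ) (b : ℤ → X₁) : ℝ :=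
  1 / ((M₁ : ℝ) * (M₂ : ℝ)) * ∑ m₁ : Fin M₁, ∑ m₂ : Fin M₂,
    ∑ y : Fin n → Y with c.dec y ≠ (m₁, m₂), law W d b (c.enc₁ m₁) (c.enc₂ m₁ m₂) y

variable {dmin dmax : ℕ}

/-- A pair of nonnegative rates is achievable if there are codes of all block lengths `n` with
`⌈2 ^ (n R₁)⌉` and `⌈2 ^ (n R₂)⌉` messages whose error probabilities are at most `ε n`, for every
delay `d` and all admissible edge symbols `b ∈ E n d`, where `ε n → 0`. -/
def Achievable (W : X₁ → X₂ → Y → ℝ) (E : ℕ → Delay dmin dmax → Set (ℤ → X₁))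
    (R : ℝ × ℝ) : Prop :=
  0 ≤ R.1 ∧ 0 ≤ R.2 ∧ ∃ ε : ℕ → ℝ, Tendsto ε atTop (𝓝 0) ∧
    ∀ n : ℕ, ∃ c : Code X₁ X₂ Y ⌈(2 : ℝ) ^ ((n : ℝ) * R.1)⌉₊ ⌈(2 : ℝ) ^ ((n : ℝ) * R.2)⌉₊ n,
      ∀ d : Delay dmin dmax, ∀ b ∈ E n d, errorProb W c d b ≤ ε n

/-- The capacity region: the closure of the set of achievable rate pairs. -/
def capacityRegion (W : X₁ → X₂ → Y → ℝ) (E : ℕ → Delay dmin dmax → Set (ℤ → X₁)) :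
    Set (ℝ × ℝ) :=
  closure {R | Achievable W E R}

/-! ### The multi-letter regions -/

/-- The nonnegative rate pairs with `R₁ + R₂ ≤ (1/n) I(X₁,X₂;Z)` and `R₂ ≤ (1/n) I(X₂;Z|X₁)`,
where the input words have joint pmf `P` and the output `Z` has conditional law `K`. -/
def ratePairs {Z : Type*} [Fintype Z] {n : ℕ} (P : (Fin n → X₁) × (Fin n → X₂) → ℝ)
    (K : (Fin n → X₁) → (Fin n → X₂) → Z → ℝ) : Set (ℝ × ℝ) :=
  {R | 0 ≤ R.1 ∧ 0 ≤ R.2 ∧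
    R.1 + R.2 ≤ 1 / (n : ℝ) *
      mutualInfo (fun (x : (Fin n → X₁) × (Fin n → X₂)) (z : Z) => P x * K x.1 x.2 z) ∧
    R.2 ≤ 1 / (n : ℝ) *
      condMutualInfo (fun (x₂ : Fin n → X₂) (z : Z) (x₁ : Fin n → X₁) =>
        P (x₁, x₂) * K x₁ x₂ z)}

/-- The region `R_n`: all `n` outputs are used. -/
def regionR (W : X₁ → X₂ → Y → ℝ) (E : ℕ → Delay dmin dmax → Set (ℤ → X₁)) (n : ℕ) :
    Set (ℝ × ℝ) :=
  ⋃ P ∈ stdSimplex ℝ ((Fin n → X₁) × (Fin n → X₂)),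
    ⋂ d : Delay dmin dmax, ⋂ b ∈ E n d, ratePairs P (law W (d : ℤ) b)

/-- The region `Q_n`: the first `dmax` and the last `dmin` outputs are discarded. -/
def regionQ (W : X₁ → X₂ → Y → ℝ) (dmin dmax n : ℕ) : Set (ℝ × ℝ) :=
  ⋃ P ∈ stdSimplex ℝ ((Fin n → X₁) × (Fin n → X₂)),
    ⋂ d : Delay dmin dmax, ratePairs P (coreLaw W d)

end Capacity

end ACMAC

end

/-! The two equalities for `regionR` and the one for `regionQ` come from one cycle of inclusions:
capacity region, closure of the liminf, closure of the limsup, closure of the union of the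
`regionQ`, capacity region. In each inclusion other than liminf in limsup, it is enough to treat `t
• R` for every `0 < t < 1`, since all the sets are closures. The slack `1 - t` absorbs every term
that is negligible against the block length.

Converse. The input law is that of the codeword pair of uniform messages. It depends neither on the
delay nor on the edge symbols, so Fano's inequality (`fano`) bounds the rates for all of them with a
single `P`.

Edge effects. Discarding `dmin + dmax` outputs costs at most `(dmin + dmax) log |Y|` nats
(`condInfo_le_add_log`), which vanishes after division by `n`.

Achievability. A block of length `N` is cut into `N / n` sub-blocks of length `n`, and the decoder
looks only at their core outputs. For every delay these depend on inputs of the same sub-block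
alone, so they form a memoryless channel over words, free of edge symbols
(`exists_code_errorProb_eq`). What remains is a compound channel with finitely many states `d`. A
superposition code is built for the uniform mixture of the product channels
(`exists_superposition_code`). Each state is dominated by `D` times the mixture, so a small error
for the mixture is a small error for every delay. The threshold tests of the decoder succeed because
the information density of the mixture concentrates above the smallest information of the states
(`tendsto_missMass_mixture`).

Both information quantities are treated at once as `condInfo` given a function `g` of the input: a
constant `g` gives mutual information, and `Prod.fst` gives the information conditional on the first
word. -/

namespace ACMAC

/-! ### Information given a function of the input, loss under output maps, Fano's inequality. -/

noncomputable section Density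

open scoped Classical

variable {X Z C : Type*} [Fintype X]

/-- The probability of the fibre of `g` over `c`. -/
def fiberMass (P : X → ℝ) (g : X → C) (c : C) : ℝ := ∑ x, if g x = c then P x else 0

/-- The output law of the channel `K` with input law `P`, given that the input `x` has `g x = c`. -/
def condOut (P : X → ℝ) (K : X → Z → ℝ) (g : X → C) (c : C) (z : Z) : ℝ :=
  (∑ x, if g x = c then P x * K x z else 0) / fiberMass P g c

/-- The conditional mutual information, in nats, of input and output given the value of `g` at
the input. -/
def condInfo [Fintype Z] (P : X → ℝ) (K : X → Z → ℝ) (g : X → C) : ℝ :=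
  ∑ x, ∑ z, P x * K x z * Real.log (K x z / condOut P K g (g x) z)

variable {P : X → ℝ} {K : X → Z → ℝ} (g : X → C)

lemma fiberMass_nonneg (hP : ∀ x, 0 ≤ P x) (c : C) : 0 ≤ fiberMass P g c :=
  Finset.sum_nonneg fun x _ => by split_ifs <;> simp [hP]

lemma le_fiberMass (hP : ∀ x, 0 ≤ P x) (x : X) : P x ≤ fiberMass P g (g x) := by
  have := Finset.single_le_sum (f := fun x' => if g x' = g x then P x' else 0)
    (fun x' _ => by split_ifs <;> simp [hP]) (Finset.mem_univ x)
  simpa [fiberMass] using this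

lemma condOut_nonneg (hP : ∀ x, 0 ≤ P x) (hK : ∀ x z, 0 ≤ K x z) (c : C) (z : Z) :
    0 ≤ condOut P K g c z :=
  div_nonneg (Finset.sum_nonneg fun x _ => by
    split_ifs <;> simp [mul_nonneg (hP x) (hK x z)]) (fiberMass_nonneg g hP c)

lemma condOut_pos (hP : ∀ x, 0 ≤ P x) (hK : ∀ x z, 0 ≤ K x z) {x : X} {z : Z}
    (hx : 0 < P x) (hz : 0 < K x z) : 0 < condOut P K g (g x) z := by
  refine div_pos ?_ (hx.trans_le (le_fiberMass g hP x))
  have := Finset.single_le_sum (f := fun x' => if g x' = g x then P x' * K x' z else 0)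
    (fun x' _ => by split_ifs <;> simp [mul_nonneg (hP x') (hK x' z)]) (Finset.mem_univ x)
  refine (mul_pos hx hz).trans_le ?_
  simpa using this

lemma condOut_of_subsingleton [Subsingleton C] (hP : P ∈ stdSimplex ℝ X) (c : C) (z : Z) :
    condOut P K g c z = ∑ x, P x * K x z := by
  have h : ∀ x, g x = c := fun x => Subsingleton.elim _ _
  simp [condOut, fiberMass, h, hP.2]

/-- The tower property: `condOut` is the conditional expectation of the likelihood given `g`. It
allows a change from `K` to the averaged output law against any test that sees the input through `g`
only. -/
lemma sum_mul_condOut (hP : ∀ x, 0 ≤ P x) (z : Z) (h : C → ℝ) :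
    ∑ x, P x * condOut P K g (g x) z * h (g x) = ∑ x, P x * K x z * h (g x) := by
  have e1 : ∀ x, P x * condOut P K g (g x) z * h (g x) =
      ∑ x', if g x' = g x then P x' * K x' z * (P x * h (g x) / fiberMass P g (g x)) else 0 := by
    intro x
    rw [condOut, Finset.sum_div, Finset.mul_sum, Finset.sum_mul]
    refine Finset.sum_congr rfl fun x' _ => ?_
    split_ifs
    · ring
    · simp
  simp_rw [e1]
  rw [Finset.sum_comm]
  refine Finset.sum_congr rfl fun x' _ => ?_
  have e2 : ∀ x, (if g x' = g x then P x' * K x' z * (P x * h (g x) / fiberMass P g (g x)) else 0)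
      = P x' * K x' z * h (g x') / fiberMass P g (g x') * (if g x = g x' then P x else 0) := by
    intro x
    by_cases hx : g x' = g x
    · rw [if_pos hx, if_pos hx.symm, hx]; ring
    · rw [if_neg hx, if_neg (Ne.symm hx), mul_zero]
  simp_rw [e2]
  rw [← Finset.mul_sum]
  change _ * fiberMass P g (g x') = _
  by_cases h0 : fiberMass P g (g x') = 0
  · have : P x' = 0 := le_antisymm (h0 ▸ le_fiberMass g hP x') (hP x')
    simp [this]
  · field_simp

variable [Fintype Z]

/-- Only an inequality, because on a fibre of mass zero the division makes `condOut` vanish. -/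
lemma sum_condOut_le_one (hK : ∀ x, K x ∈ stdSimplex ℝ Z) (c : C) :
    ∑ z, condOut P K g c z ≤ 1 := by
  unfold condOut
  rw [← Finset.sum_div, Finset.sum_comm]
  have : ∑ x, ∑ z, (if g x = c then P x * K x z else 0) = fiberMass P g c := by
    refine Finset.sum_congr rfl fun x _ => ?_
    split_ifs
    · rw [← Finset.mul_sum, (hK x).2, mul_one]
    · simp
  rw [this]
  exact div_self_le_one _

lemma sum_sum_mul_condOut_le_one (hP : P ∈ stdSimplex ℝ X) (hK : ∀ x, K x ∈ stdSimplex ℝ Z) :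
    ∑ x, ∑ z, P x * condOut P K g (g x) z ≤ 1 := by
  rw [← hP.2]
  refine Finset.sum_le_sum fun x _ => ?_
  rw [← Finset.mul_sum]
  exact mul_le_of_le_one_right (hP.1 x) (sum_condOut_le_one g hK _)

lemma sum_sum_mul_eq_one (hP : P ∈ stdSimplex ℝ X) (hK : ∀ x, K x ∈ stdSimplex ℝ Z) :
    ∑ x, ∑ z, P x * K x z = 1 := by
  simp_rw [← Finset.mul_sum, (hK _).2, mul_one]
  exact hP.2

/-- `a log (a / b) ≥ a log c + a - c b`. -/
lemma mul_log_add_sub_le {a b c : ℝ} (ha : 0 ≤ a) (hb : 0 ≤ b) (hab : 0 < a → 0 < b)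
    (hc : 0 < c) : a * Real.log c + a - c * b ≤ a * Real.log (a / b) := by
  rcases ha.eq_or_lt with rfl | ha
  · simp; positivity
  have hb' := hab ha
  have h := Real.log_le_sub_one_of_pos (x := c * b / a) (by positivity)
  rw [Real.log_div (by positivity) ha.ne', Real.log_mul hc.ne' hb'.ne'] at h
  rw [Real.log_div ha.ne' hb'.ne']
  have h2 := mul_le_mul_of_nonneg_left h ha.le
  have h3 : a * (c * b / a - 1) = c * b - a := by field_simp
  nlinarith

lemma condInfo_nonneg (hP : P ∈ stdSimplex ℝ X) (hK : ∀ x, K x ∈ stdSimplex ℝ Z) :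
    0 ≤ condInfo P K g := by
  have h : ∑ x, ∑ z, (P x * K x z - P x * condOut P K g (g x) z) ≤ condInfo P K g := by
    refine Finset.sum_le_sum fun x _ => Finset.sum_le_sum fun z _ => ?_
    rcases (hP.1 x).eq_or_lt with h0 | h0
    · simp [← h0]
    have := mul_log_add_sub_le (c := 1) ((hK x).1 z)
      (condOut_nonneg g hP.1 (fun x => (hK x).1) (g x) z)
      (condOut_pos g hP.1 (fun x => (hK x).1) h0) one_pos
    have h2 := mul_le_mul_of_nonneg_left this h0.le
    rw [Real.log_one] at h2
    linarith
  simp only [Finset.sum_sub_distrib] at h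
  rw [sum_sum_mul_eq_one hP hK] at h
  linarith [sum_sum_mul_condOut_le_one g hP hK]

/-- Mutual information in terms of the channel and the output law. -/
lemma mutualInfo_eq (hP : P ∈ stdSimplex ℝ X) (hK : ∀ x, K x ∈ stdSimplex ℝ Z) :
    mutualInfo (fun x z => P x * K x z) = condInfo P K (fun _ => ()) / Real.log 2 := by
  unfold mutualInfo condInfo
  simp_rw [Finset.sum_div]
  refine Finset.sum_congr rfl fun x _ => Finset.sum_congr rfl fun z _ => ?_
  rw [condOut_of_subsingleton _ hP, ← Finset.mul_sum, (hK x).2, mul_one, Real.logb, ← mul_div_assoc]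
  by_cases h : P x = 0
  · simp [h]
  · rw [mul_div_mul_left _ _ h]

/-- Conditional mutual information in terms of the channel and the conditional output law. -/
lemma condMutualInfo_eq {X₁ X₂ : Type*} [Fintype X₁] [Fintype X₂] {P : X₁ × X₂ → ℝ}
    {K : X₁ × X₂ → Z → ℝ} (hK : ∀ x, K x ∈ stdSimplex ℝ Z) :
    condMutualInfo (fun x₂ z x₁ => P (x₁, x₂) * K (x₁, x₂) z) =
      condInfo P K Prod.fst / Real.log 2 := by
  unfold condMutualInfo condInfo
  rw [Fintype.sum_prod_type]
  simp_rw [Finset.sum_div]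
  conv_rhs => rw [Finset.sum_comm]
  refine Finset.sum_congr rfl fun x₂ _ => ?_
  rw [Finset.sum_comm]
  refine Finset.sum_congr rfl fun x₁ _ => Finset.sum_congr rfl fun z _ => ?_
  have e1 : ∑ x₂', ∑ z', P (x₁, x₂') * K (x₁, x₂') z' = fiberMass P Prod.fst x₁ := by
    simp_rw [← Finset.mul_sum, (hK _).2, mul_one, fiberMass, Fintype.sum_prod_type]
    rw [Finset.sum_comm]
    simp
  have e2 : ∑ z', P (x₁, x₂) * K (x₁, x₂) z' = P (x₁, x₂) := by
    rw [← Finset.mul_sum, (hK _).2, mul_one]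
  have e3 : condOut P K Prod.fst x₁ z =
      (∑ x₂', P (x₁, x₂') * K (x₁, x₂') z) / fiberMass P Prod.fst x₁ := by
    rw [condOut, Fintype.sum_prod_type]
    congr 1
    rw [Finset.sum_comm]
    simp
  rw [e1, e2, e3, Real.logb, ← mul_div_assoc]
  by_cases h : P (x₁, x₂) = 0
  · simp [h]
  · rw [div_div_eq_mul_div, mul_assoc _ _ (fiberMass _ _ _), mul_div_mul_left _ _ h]

/-- The image `π` of the output loses at most `log L` nats of information, if its fibres have at
most `L` elements. -/
lemma condInfo_le_add_log {Z' : Type*} [Fintype Z'] {K' : X → Z' → ℝ} {π : Z → Z'} {L : ℝ}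
    (hP : P ∈ stdSimplex ℝ X) (hK : ∀ x, K x ∈ stdSimplex ℝ Z) (hK' : ∀ x, K' x ∈ stdSimplex ℝ Z')
    (hmap : ∀ x (F : Z' → ℝ), ∑ z, F (π z) * K x z = ∑ z', F z' * K' x z')
    (hle : ∀ x z, K x z ≤ K' x (π z)) (hL : 0 < L)
    (hfib : ∀ F : Z' → ℝ, (∀ z', 0 ≤ F z') → ∑ z, F (π z) ≤ L * ∑ z', F z') :
    condInfo P K g ≤ condInfo P K' g + Real.log L := by
  have hK0 : ∀ x z, 0 ≤ K x z := fun x => (hK x).1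
  have hK0' : ∀ x z, 0 ≤ K' x z := fun x => (hK' x).1
  have e : condInfo P K' g =
      ∑ x, ∑ z, P x * K x z * Real.log (K' x (π z) / condOut P K' g (g x) (π z)) := by
    unfold condInfo
    refine Finset.sum_congr rfl fun x _ => ?_
    have := hmap x fun z' => P x * Real.log (K' x z' / condOut P K' g (g x) z')
    calc _ = ∑ z', P x * Real.log (K' x z' / condOut P K' g (g x) z') * K' x z' :=
          Finset.sum_congr rfl fun _ _ => by ring
      _ = _ := by rw [← this]; exact Finset.sum_congr rfl fun _ _ => by ring
  -- With `Q`, `Q'` the two conditional output laws: `K` is replaced by the larger `K'` in the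
  -- logarithm, and the remaining `log (Q' / (L Q))` is at most `Q' / (L Q) - 1`. The mean of `Q' /
  -- (L Q)` is at most `1` by the fibre bound, so the `-1` cancels it and only `log L` survives.
  have hterm : ∀ x z, P x * K x z * Real.log (K x z / condOut P K g (g x) z) ≤
      P x * K x z * Real.log (K' x (π z) / condOut P K' g (g x) (π z)) +
        (P x * K x z * (condOut P K' g (g x) (π z) / (L * condOut P K g (g x) z)) +
          P x * K x z * (Real.log L - 1)) := by
    intro x z
    rcases (hP.1 x).eq_or_lt with h0 | h0
    · simp [← h0]
    rcases (hK0 x z).eq_or_lt with h1 | h1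
    · simp [← h1]
    have h1' := h1.trans_le (hle x z)
    have hQ := condOut_pos g hP.1 hK0 h0 h1
    have hQ' := condOut_pos g hP.1 hK0' h0 h1'
    rw [← mul_add, ← mul_add]
    refine mul_le_mul_of_nonneg_left ?_ (by positivity)
    have h2 := Real.log_le_sub_one_of_pos
      (x := condOut P K' g (g x) (π z) / (L * condOut P K g (g x) z)) (by positivity)
    have h3 := Real.log_le_log h1 (hle x z)
    rw [Real.log_div hQ'.ne' (by positivity), Real.log_mul hL.ne' hQ.ne'] at h2
    rw [Real.log_div h1.ne' hQ.ne', Real.log_div h1'.ne' hQ'.ne']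
    linarith
  have hsum := Finset.sum_le_sum fun x (_ : x ∈ Finset.univ) =>
    Finset.sum_le_sum fun z (_ : z ∈ Finset.univ) => hterm x z
  simp only [Finset.sum_add_distrib] at hsum
  rw [← e] at hsum
  have hlast : ∑ x, ∑ z, P x * K x z * (Real.log L - 1) = Real.log L - 1 := by
    simp_rw [← Finset.sum_mul]
    rw [sum_sum_mul_eq_one hP hK, one_mul]
  have hmid : ∑ x, ∑ z, P x * K x z * (condOut P K' g (g x) (π z) /
      (L * condOut P K g (g x) z)) ≤ 1 := by
    rw [Finset.sum_comm]
    have h1 : ∀ z, ∑ x, P x * K x z * (condOut P K' g (g x) (π z) / (L * condOut P K g (g x) z))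
        ≤ ∑ x, P x * condOut P K' g (g x) (π z) / L := by
      intro z
      rw [← sum_mul_condOut g hP.1 z fun c => condOut P K' g c (π z) / (L * condOut P K g c z)]
      refine Finset.sum_le_sum fun x _ => ?_
      have hQ' := condOut_nonneg g hP.1 hK0' (g x) (π z)
      rcases (condOut_nonneg g hP.1 hK0 (g x) z).eq_or_lt with h | h
      · rw [← h]; have := hP.1 x; simp; positivity
      · apply le_of_eq; field_simp
    refine (Finset.sum_le_sum fun z _ => h1 z).trans ?_
    rw [Finset.sum_comm]
    refine (Finset.sum_le_sum (g := fun x => P x) fun x _ => ?_).trans_eq hP.2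
    have h2 := hfib (fun z' => condOut P K' g (g x) z') fun z' => condOut_nonneg g hP.1 hK0' _ _
    have h3 := sum_condOut_le_one (P := P) g hK' (g x)
    rw [← Finset.sum_div, ← Finset.mul_sum, div_le_iff₀ hL]
    refine mul_le_mul_of_nonneg_left (h2.trans ?_) (hP.1 x)
    nlinarith
  unfold condInfo at hsum ⊢
  linarith

/-- The law of a uniformly chosen codeword. -/
def codewordLaw {M : Type*} [Fintype M] (e : M → X) (x : X) : ℝ :=
  ∑ m, if e m = x then 1 / (Fintype.card M : ℝ) else 0

lemma codewordLaw_mem {M : Type*} [Fintype M] [Nonempty M] (e : M → X) :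
    codewordLaw e ∈ stdSimplex ℝ X := by
  refine ⟨fun x => Finset.sum_nonneg fun m _ => by split_ifs <;> positivity, ?_⟩
  unfold codewordLaw
  rw [Finset.sum_comm]
  simp

/-- Fano's inequality, for the uniform law on the codewords `e m`, a decoder `f` and its average
error probability `err`. -/
lemma fano {M : Type*} [Fintype M] [Nonempty M] [DecidableEq M] (e : M → X) (f : Z → M) {c : ℝ}
    (hc : 0 < c) (hK : ∀ x, K x ∈ stdSimplex ℝ Z) {err : ℝ}
    (herr : err = 1 / (Fintype.card M : ℝ) * ∑ m, ∑ z with f z ≠ m, K (e m) z)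
    (hQ : c * ∑ m, ∑ z with f z = m, condOut (codewordLaw e) K g (g (e m)) z ≤ Fintype.card M) :
    (1 - err) * Real.log c - 1 ≤ condInfo (codewordLaw e) K g := by
  have hM : 0 < (Fintype.card M : ℝ) := by exact_mod_cast Fintype.card_pos
  set P := codewordLaw e with hPdef
  have hP : ∀ x, P x = ∑ m, if e m = x then 1 / (Fintype.card M : ℝ) else 0 := fun x => rfl
  have hP0 : ∀ x, 0 ≤ P x := (codewordLaw_mem e).1
  have hPpos : ∀ m, 0 < P (e m) := fun m => by
    rw [hP]
    refine Finset.sum_pos' (fun m _ => by split_ifs <;> positivity) ⟨m, Finset.mem_univ _, ?_⟩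
    simp [hM]
  have hK0 : ∀ x z, 0 ≤ K x z := fun x => (hK x).1
  have hsum : ∀ F : X → ℝ, ∑ x, P x * F x = 1 / (Fintype.card M : ℝ) * ∑ m, F (e m) := by
    intro F
    simp_rw [hP, Finset.sum_mul]
    rw [Finset.sum_comm, Finset.mul_sum]
    refine Finset.sum_congr rfl fun m _ => ?_
    simp [ite_mul]
  have e1 : condInfo P K g = 1 / (Fintype.card M : ℝ) *
      ∑ m, ∑ z, K (e m) z * Real.log (K (e m) z / condOut P K g (g (e m)) z) := by
    rw [condInfo, ← hsum fun x => ∑ z, K x z * Real.log (K x z / condOut P K g (g x) z)]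
    simp_rw [Finset.mul_sum, mul_assoc]
  have hm : ∀ m, Real.log c + 1 - 1 - Real.log c * ∑ z with f z ≠ m, K (e m) z -
      c * ∑ z with f z = m, condOut P K g (g (e m)) z ≤
      ∑ z, K (e m) z * Real.log (K (e m) z / condOut P K g (g (e m)) z) := by
    intro m
    have hb := fun z => condOut_nonneg g hP0 hK0 (g (e m)) z
    have hab := fun z => condOut_pos g hP0 hK0 (z := z) (hPpos m)
    have h1 : ∑ z, (K (e m) z * Real.log c + K (e m) z - condOut P K g (g (e m)) z
        - Real.log c * (if f z ≠ m then K (e m) z else 0)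
        - c * (if f z = m then condOut P K g (g (e m)) z else 0)) ≤
      ∑ z, K (e m) z * Real.log (K (e m) z / condOut P K g (g (e m)) z) := by
      refine Finset.sum_le_sum fun z _ => ?_
      have := hb z
      -- The tangent bound is used with the constant `c` on correctly decoded outputs and with `1`
      -- on the others, so that only the former contribute `log c`.
      by_cases h : f z = m
      · have h2 := mul_log_add_sub_le (hK0 (e m) z) (hb z) (hab z) hc
        simp only [h, ne_eq, not_true, if_false, if_true]
        linarith
      · have h2 := mul_log_add_sub_le (hK0 (e m) z) (hb z) (hab z) one_pos
        rw [Real.log_one] at h2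
        simp only [h, ne_eq, not_false_eq_true, if_false, if_true]
        linarith
    simp only [Finset.sum_sub_distrib, Finset.sum_add_distrib, ← Finset.mul_sum, ← Finset.sum_mul,
      (hK (e m)).2, one_mul, ← Finset.sum_filter] at h1
    have h3 := sum_condOut_le_one (P := P) g hK (g (e m))
    linarith
  have h4 := Finset.sum_le_sum fun m (_ : m ∈ Finset.univ) => hm m
  simp only [Finset.sum_sub_distrib, ← Finset.mul_sum, Finset.sum_const, Finset.card_univ,
    nsmul_eq_mul] at h4
  rw [e1, herr, one_div_mul_eq_div, one_div_mul_eq_div, le_div_iff₀ hM]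
  have h5 : ((1 - (∑ m, ∑ z with f z ≠ m, K (e m) z) / (Fintype.card M : ℝ)) * Real.log c - 1) *
      Fintype.card M = Fintype.card M * Real.log c
        - Real.log c * ∑ m, ∑ z with f z ≠ m, K (e m) z - Fintype.card M := by
    field_simp
  rw [h5]
  linarith

end Density

/-! ### Product channels, mixtures and concentration of the information density. -/

noncomputable section Product

open scoped Classical

variable {X Z C : Type*}

/-- The `k`-fold product of a law. -/
def powLaw (P : X → ℝ) (k : ℕ) (x : Fin k → X) : ℝ := ∏ j, P (x j)

/-- The `k`-fold memoryless use of a channel. -/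
def powChannel (K : X → Z → ℝ) (k : ℕ) (x : Fin k → X) (z : Fin k → Z) : ℝ := ∏ j, K (x j) (z j)

/-- The uniform mixture of a family of channels. -/
def mixture {S : Type*} [Fintype S] (K : S → X → Z → ℝ) (x : X) (z : Z) : ℝ :=
  (∑ s, K s x z) / Fintype.card S

section

variable [Fintype X] {P : X → ℝ} {K : X → Z → ℝ} (g : X → C)

lemma powLaw_mem (hP : P ∈ stdSimplex ℝ X) (k : ℕ) : powLaw P k ∈ stdSimplex ℝ (Fin k → X) := by
  refine ⟨fun x => Finset.prod_nonneg fun j _ => hP.1 _, ?_⟩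
  have := Finset.prod_univ_sum (fun _ : Fin k => (Finset.univ : Finset X)) fun _ x => P x
  simp only [hP.2, Finset.prod_const_one, Fintype.piFinset_univ] at this
  exact this.symm

lemma condOut_pow (k : ℕ) (c : Fin k → C) (z : Fin k → Z) :
    condOut (powLaw P k) (powChannel K k) (fun x j => g (x j)) c z =
      ∏ j, condOut P K g (c j) (z j) := by
  have key : ∀ F : Fin k → X → ℝ, (∑ x : Fin k → X, if (fun j => g (x j)) = c then
      ∏ j, F j (x j) else 0) = ∏ j, ∑ x, if g x = c j then F j x else 0 := by
    intro F
    rw [Finset.prod_univ_sum, Fintype.piFinset_univ]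
    refine Finset.sum_congr rfl fun x _ => ?_
    rw [Finset.prod_ite_zero]
    simp [funext_iff]
  simp only [condOut, fiberMass, powLaw, powChannel, ← Finset.prod_mul_distrib,
    Finset.prod_div_distrib]
  convert congrArg₂ (· / ·) (key fun j x => P x * K x (z j)) (key fun _ x => P x)

end

variable [Fintype Z]

lemma powChannel_mem {K : X → Z → ℝ} (hK : ∀ x, K x ∈ stdSimplex ℝ Z) (k : ℕ) (x : Fin k → X) :
    powChannel K k x ∈ stdSimplex ℝ (Fin k → Z) := by
  refine ⟨fun z => Finset.prod_nonneg fun j _ => (hK _).1 _, ?_⟩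
  have := Finset.prod_univ_sum (fun _ : Fin k => (Finset.univ : Finset Z)) fun j z => K (x j) z
  simp only [(hK _).2, Finset.prod_const_one, Fintype.piFinset_univ] at this
  exact this.symm

lemma mixture_mem {S : Type*} [Fintype S] [Nonempty S] {K : S → X → Z → ℝ}
    (hK : ∀ s x, K s x ∈ stdSimplex ℝ Z) (x : X) : mixture K x ∈ stdSimplex ℝ Z := by
  have h : (Fintype.card S : ℝ) ≠ 0 := by exact_mod_cast Fintype.card_ne_zero
  refine ⟨fun z => div_nonneg (Finset.sum_nonneg fun s _ => (hK s x).1 z) (by positivity), ?_⟩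
  simp only [mixture]
  rw [← Finset.sum_div, Finset.sum_comm]
  simp [(hK _ x).2, h]

variable [Fintype X]

/-- The probability that the likelihood `K x z` is at most `G` times the likelihood of `z` given
`g x`. -/
def missMass (P : X → ℝ) (K : X → Z → ℝ) (g : X → C) (G : ℝ) : ℝ :=
  ∑ x, ∑ z, if K x z ≤ G * condOut P K g (g x) z then P x * K x z else 0

variable {P : X → ℝ} {K : X → Z → ℝ} (g : X → C)

lemma missMass_nonneg (hP : ∀ x, 0 ≤ P x) (hK : ∀ x z, 0 ≤ K x z) (G : ℝ) :
    0 ≤ missMass P K g G :=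
  Finset.sum_nonneg fun x _ => Finset.sum_nonneg fun z _ => by
    split_ifs <;> simp [mul_nonneg (hP x) (hK x z)]

lemma missMass_mono (hP : ∀ x, 0 ≤ P x) (hK : ∀ x z, 0 ≤ K x z) {G G' : ℝ} (h : G ≤ G') :
    missMass P K g G ≤ missMass P K g G' := by
  refine Finset.sum_le_sum fun x _ => Finset.sum_le_sum fun z _ => ?_
  have h1 := mul_nonneg (hP x) (hK x z)
  have h2 := mul_le_mul_of_nonneg_right h (condOut_nonneg g hP hK (g x) z)
  split_ifs with h3 h4
  · rfl
  · exact absurd (h3.trans h2) h4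
  · exact h1
  · rfl

/-- The threshold `0` never rejects the true input. It serves the zero rates, where concentration
may be unavailable because the information can be `0`. -/
lemma missMass_zero (hK : ∀ x z, 0 ≤ K x z) : missMass P K g 0 = 0 := by
  refine Finset.sum_eq_zero fun x _ => Finset.sum_eq_zero fun z _ => ?_
  split_ifs with h
  · rw [zero_mul] at h
    rw [le_antisymm h (hK x z), mul_zero]
  · rfl

/-- Chernoff's bound: on the support, the event says that the sum of the `k` densities is at most `γ
k`, so its indicator is at most `exp (l (γ k - sum))`, whose expectation factorises. -/
lemma missMass_pow_le (hP : P ∈ stdSimplex ℝ X) (hK : ∀ x, K x ∈ stdSimplex ℝ Z) {γ l : ℝ}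
    (hl : 0 ≤ l) (k : ℕ) :
    missMass (powLaw P k) (powChannel K k) (fun x j => g (x j)) (Real.exp (γ * k)) ≤
      (∑ x, ∑ z, P x * K x z *
        Real.exp (l * (γ - Real.log (K x z / condOut P K g (g x) z)))) ^ k := by
  have hK0 : ∀ x z, 0 ≤ K x z := fun x => (hK x).1
  have e : (∑ x, ∑ z, P x * K x z *
        Real.exp (l * (γ - Real.log (K x z / condOut P K g (g x) z)))) ^ k =
      ∑ x : Fin k → X, ∑ z : Fin k → Z, ∏ j, (P (x j) * K (x j) (z j) *
        Real.exp (l * (γ - Real.log (K (x j) (z j) / condOut P K g (g (x j)) (z j))))) := by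
    have h1 := Finset.prod_univ_sum (fun _ : Fin k => (Finset.univ : Finset X)) fun _ x =>
      ∑ z, P x * K x z * Real.exp (l * (γ - Real.log (K x z / condOut P K g (g x) z)))
    rw [Finset.prod_const, Finset.card_univ, Fintype.card_fin, Fintype.piFinset_univ] at h1
    rw [h1]
    refine Finset.sum_congr rfl fun x _ => ?_
    rw [Finset.prod_univ_sum, Fintype.piFinset_univ]
  rw [e]
  refine Finset.sum_le_sum fun x _ => Finset.sum_le_sum fun z _ => ?_
  have hnn : ∀ j, 0 ≤ P (x j) * K (x j) (z j) := fun j => mul_nonneg (hP.1 _) (hK0 _ _)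
  rw [Finset.prod_mul_distrib]
  have hpr : powLaw P k x * powChannel K k x z = ∏ j, (P (x j) * K (x j) (z j)) := by
    simp [powLaw, powChannel, Finset.prod_mul_distrib]
  split_ifs with h
  · rw [hpr]
    by_cases h0 : ∃ j, P (x j) * K (x j) (z j) = 0
    · obtain ⟨j, hj⟩ := h0
      rw [Finset.prod_eq_zero (Finset.mem_univ j) hj, zero_mul]
    push Not at h0
    have hKp : ∀ j, 0 < K (x j) (z j) := fun j =>
      (hK0 _ _).lt_of_ne' (right_ne_zero_of_mul (h0 j))
    have hPp : ∀ j, 0 < P (x j) := fun j => (hP.1 _).lt_of_ne' (left_ne_zero_of_mul (h0 j))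
    have hQp : ∀ j, 0 < condOut P K g (g (x j)) (z j) := fun j =>
      condOut_pos g hP.1 hK0 (hPp j) (hKp j)
    refine le_mul_of_one_le_right (Finset.prod_nonneg fun j _ => hnn j) ?_
    rw [← Real.exp_sum, Real.one_le_exp_iff, ← Finset.mul_sum]
    refine mul_nonneg hl ?_
    rw [condOut_pow, powChannel] at h
    have h2 := Real.log_le_log (Finset.prod_pos fun j _ => hKp j) h
    rw [Real.log_mul (Real.exp_pos _).ne' (Finset.prod_pos fun j _ => hQp j).ne', Real.log_exp,
      Real.log_prod fun j _ => (hKp j).ne', Real.log_prod fun j _ => (hQp j).ne'] at h2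
    have h3 : ∀ j, Real.log (K (x j) (z j) / condOut P K g (g (x j)) (z j)) =
        Real.log (K (x j) (z j)) - Real.log (condOut P K g (g (x j)) (z j)) := fun j =>
      Real.log_div (hKp j).ne' (hQp j).ne'
    simp only [h3, Finset.sum_sub_distrib, Finset.sum_const, Finset.card_univ, Fintype.card_fin,
      nsmul_eq_mul]
    linarith
  · exact mul_nonneg (Finset.prod_nonneg fun j _ => hnn j)
      (Finset.prod_nonneg fun j _ => (Real.exp_pos _).le)

/-- The weak law of large numbers for the information density, below its mean. -/
lemma tendsto_missMass_pow (hP : P ∈ stdSimplex ℝ X) (hK : ∀ x, K x ∈ stdSimplex ℝ Z) {γ : ℝ}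
    (hγ : γ < condInfo P K g) :
    Tendsto (fun k : ℕ => missMass (powLaw P k) (powChannel K k) (fun x j => g (x j))
      (Real.exp (γ * k))) atTop (𝓝 0) := by
  set φ : ℝ → ℝ := fun l => ∑ x, ∑ z, P x * K x z *
        Real.exp (l * (γ - Real.log (K x z / condOut P K g (g x) z))) with hφ
  have hφ0 : φ 0 = 1 := by simp [hφ, sum_sum_mul_eq_one hP hK]
  have hφnn : ∀ l, 0 ≤ φ l := fun l => Finset.sum_nonneg fun x _ => Finset.sum_nonneg fun z _ =>
    mul_nonneg (mul_nonneg (hP.1 x) ((hK x).1 z)) (Real.exp_pos _).le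
  have hd : HasDerivAt φ (γ - condInfo P K g) 0 := by
    have h1 : HasDerivAt φ (∑ x, ∑ z, P x * K x z *
        (γ - Real.log (K x z / condOut P K g (g x) z))) 0 := by
      refine HasDerivAt.fun_sum fun x _ => HasDerivAt.fun_sum fun z _ => ?_
      refine HasDerivAt.const_mul _ ?_
      have := ((hasDerivAt_id (0 : ℝ)).mul_const
        (γ - Real.log (K x z / condOut P K g (g x) z))).exp
      simpa using this
    convert h1 using 1
    simp only [mul_sub, Finset.sum_sub_distrib, ← Finset.sum_mul, sum_sum_mul_eq_one hP hK, one_mul]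
    rfl
  -- `φ 0 = 1` and `φ` has negative slope `γ - condInfo P K g` at `0`, so `φ` drops below `1` just
  -- to the right of `0`.
  obtain ⟨l, hl, hl1⟩ : ∃ l, 0 < l ∧ φ l < 1 := by
    have h1 := (hasDerivAt_iff_tendsto_slope.1 hd).mono_left
      (nhdsWithin_mono 0 fun x (hx : x ∈ Set.Ioi 0) => (ne_of_gt hx : x ≠ 0))
    have h2 := (h1.eventually_lt_const (sub_neg.2 hγ)).and self_mem_nhdsWithin
    obtain ⟨l, h3, h4⟩ := h2.exists
    refine ⟨l, h4, ?_⟩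
    rw [slope_def_field, hφ0, sub_zero, div_lt_iff₀ h4, zero_mul] at h3
    linarith
  refine squeeze_zero (fun k => ?_) (fun k => missMass_pow_le g hP hK hl.le k)
    (tendsto_pow_atTop_nhds_zero_of_lt_one (hφnn l) hl1)
  exact missMass_nonneg _ (powLaw_mem hP k).1 (fun x => (powChannel_mem hK k x).1) _

/-- Under state `s`, the output law of the mixture exceeds `a` times that of `K s` with probability
at most `1 / a`, by Markov's inequality and `sum_mul_condOut`. Off this event, a failed test for the
mixture is a failed test for `K s`, since the mixture is at least `K s / |S|`. -/
lemma missMass_mixture_le {S : Type*} [Fintype S] [Nonempty S] {K : S → X → Z → ℝ}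
    (hP : P ∈ stdSimplex ℝ X) (hK : ∀ s x, K s x ∈ stdSimplex ℝ Z) {G a : ℝ} (hG : 0 ≤ G)
    (ha : 0 < a) :
    missMass P (mixture K) g G ≤
      ∑ s, (missMass P (K s) g (Fintype.card S * G * a) + a⁻¹) := by
  have hS : 1 ≤ (Fintype.card S : ℝ) := by exact_mod_cast Fintype.card_pos
  have hS0 : 0 < (Fintype.card S : ℝ) := one_pos.trans_le hS
  have hK0 : ∀ s x z, 0 ≤ K s x z := fun s x => (hK s x).1
  have hM := mixture_mem hK
  set Q := condOut P (mixture K) g with hQ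
  have hQ0 : ∀ c z, 0 ≤ Q c z := condOut_nonneg g hP.1 fun x => (hM x).1
  have hterm : ∀ x z, (if mixture K x z ≤ G * Q (g x) z then P x * mixture K x z else 0) ≤
      ∑ s, ((if K s x z ≤ Fintype.card S * G * a * condOut P (K s) g (g x) z then
        P x * K s x z else 0) +
        P x * K s x z * if a * condOut P (K s) g (g x) z < Q (g x) z then 1 else 0) := by
    intro x z
    have hnn : ∀ s, 0 ≤ P x * K s x z := fun s => mul_nonneg (hP.1 x) (hK0 s x z)
    split_ifs with h
    · have h1 : P x * mixture K x z ≤ ∑ s, P x * K s x z := by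
        rw [mixture, ← Finset.mul_sum]
        exact mul_le_mul_of_nonneg_left
          (div_le_self (Finset.sum_nonneg fun s _ => hK0 s x z) hS) (hP.1 x)
      refine h1.trans (Finset.sum_le_sum fun s _ => ?_)
      by_cases h2 : a * condOut P (K s) g (g x) z < Q (g x) z
      · rw [if_pos h2, mul_one]
        refine le_add_of_nonneg_left ?_
        split_ifs <;> simp [hnn]
      · rw [if_neg h2, if_pos, mul_zero, add_zero]
        have h3 : K s x z / Fintype.card S ≤ mixture K x z :=
          div_le_div_of_nonneg_right (Finset.single_le_sum (f := fun s => K s x z)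
            (fun s _ => hK0 s x z) (Finset.mem_univ s)) hS0.le
        have h4 := h3.trans (h.trans (mul_le_mul_of_nonneg_left (not_lt.1 h2) hG))
        rw [div_le_iff₀ hS0] at h4
        linarith
    · refine Finset.sum_nonneg fun s _ => add_nonneg ?_ (mul_nonneg (hnn s) ?_) <;> split_ifs <;>
        simp [hnn]
  have hsecond : ∀ s, ∑ x, ∑ z, (P x * K s x z *
      if a * condOut P (K s) g (g x) z < Q (g x) z then 1 else 0) ≤ a⁻¹ := by
    intro s
    have h1 : ∑ x, ∑ z, (P x * K s x z *
        if a * condOut P (K s) g (g x) z < Q (g x) z then 1 else 0) ≤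
        ∑ x, ∑ z, a⁻¹ * (P x * Q (g x) z) := by
      rw [Finset.sum_comm]
      conv_rhs => rw [Finset.sum_comm]
      refine Finset.sum_le_sum fun z _ => ?_
      rw [← sum_mul_condOut g hP.1 z fun c =>
        if a * condOut P (K s) g c z < Q c z then (1 : ℝ) else 0]
      refine Finset.sum_le_sum fun x _ => ?_
      have h2 := mul_nonneg (hP.1 x) (hQ0 (g x) z)
      split_ifs with h
      · rw [mul_one, le_inv_mul_iff₀ ha, mul_left_comm]
        exact mul_le_mul_of_nonneg_left h.le (hP.1 x)
      · rw [mul_zero]; positivity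
    refine h1.trans ?_
    simp_rw [← Finset.mul_sum]
    refine mul_le_of_le_one_right (by positivity) ?_
    simp_rw [Finset.mul_sum]
    exact sum_sum_mul_condOut_le_one g hP hM
  calc missMass P (mixture K) g G ≤ ∑ x, ∑ z, ∑ s,
      ((if K s x z ≤ Fintype.card S * G * a * condOut P (K s) g (g x) z then
        P x * K s x z else 0) +
        P x * K s x z * if a * condOut P (K s) g (g x) z < Q (g x) z then 1 else 0) :=
        Finset.sum_le_sum fun x _ => Finset.sum_le_sum fun z _ => hterm x z
    _ = ∑ s, (missMass P (K s) g (Fintype.card S * G * a) + ∑ x, ∑ z, (P x * K s x z *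
      if a * condOut P (K s) g (g x) z < Q (g x) z then 1 else 0)) := by
        rw [Finset.sum_congr rfl fun x _ => Finset.sum_comm, Finset.sum_comm]
        simp only [Finset.sum_add_distrib]
        rfl
    _ ≤ _ := Finset.sum_le_sum fun s _ => by have := hsecond s; linarith

/-- Below the smallest of the conditional informations of the channels `K s`, the information
density of the mixture of their products concentrates. -/
lemma tendsto_missMass_mixture {S : Type*} [Fintype S] [Nonempty S] {K : S → X → Z → ℝ}
    (hP : P ∈ stdSimplex ℝ X) (hK : ∀ s x, K s x ∈ stdSimplex ℝ Z) {γ : ℝ}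
    (hγ : ∀ s, γ < condInfo P (K s) g) :
    Tendsto (fun k : ℕ => missMass (powLaw P k) (mixture fun s => powChannel (K s) k)
      (fun x j => g (x j)) (Real.exp (γ * k))) atTop (𝓝 0) := by
  obtain ⟨s₀, hs₀⟩ := Finite.exists_min fun s => condInfo P (K s) g
  -- One third pays for `a = exp (η k)`, one for the factor `|S|`, and the last keeps `γ + 2 η`
  -- strictly below all the informations.
  set η := (condInfo P (K s₀) g - γ) / 3 with hη
  have hη0 : 0 < η := by have := hγ s₀; rw [hη]; linarith
  have hlt : ∀ s, γ + 2 * η < condInfo P (K s) g := fun s => by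
    have := hs₀ s
    have : 3 * η = condInfo P (K s₀) g - γ := by rw [hη]; ring
    linarith
  have hexp : Tendsto (fun k : ℕ => Real.exp (η * k)) atTop atTop :=
    Real.tendsto_exp_atTop.comp (tendsto_natCast_atTop_atTop.const_mul_atTop hη0)
  have hpk := fun k => powLaw_mem hP k
  have hKk := fun k s => powChannel_mem (hK s) k
  have hlim : Tendsto (fun k : ℕ => ∑ s, (missMass (powLaw P k) (powChannel (K s) k)
      (fun x j => g (x j)) (Real.exp ((γ + 2 * η) * k)) + (Real.exp (η * k))⁻¹)) atTop (𝓝 0) := by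
    rw [show (0 : ℝ) = ∑ _s : S, ((0 : ℝ) + 0) by simp]
    exact tendsto_finsetSum _ fun s _ =>
      (tendsto_missMass_pow g hP (hK s) (hlt s)).add hexp.inv_tendsto_atTop
  refine squeeze_zero' (Eventually.of_forall fun k => ?_) ?_ hlim
  · exact missMass_nonneg _ (hpk k).1 (fun x => (mixture_mem (hKk k) x).1) _
  · filter_upwards [hexp.eventually_ge_atTop (Fintype.card S : ℝ)] with k hk
    refine (missMass_mixture_le _ (hpk k) (hKk k) (Real.exp_pos _).le
      (Real.exp_pos (η * k))).trans (Finset.sum_le_sum fun s _ => ?_)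
    have h1 : Fintype.card S * Real.exp (γ * k) * Real.exp (η * k) ≤
        Real.exp ((γ + 2 * η) * k) := by
      rw [show (γ + 2 * η) * k = η * k + γ * k + η * k by ring, Real.exp_add, Real.exp_add]
      gcongr
    exact add_le_add_left (missMass_mono _ (hpk k).1 (fun x => (hKk k s x).1) h1) _

end Product

/-- The marginal of a product law on the coordinates in the range of an injection. -/
lemma sum_comp_mul_prod {ι κ Y : Type*} [Fintype ι] [Fintype κ] [Fintype Y] {φ : κ → ι}
    (hφ : Function.Injective φ) (w : ι → Y → ℝ) (hw : ∀ i, ∑ y, w i y = 1) [DecidableEq ι]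
    [DecidableEq κ] (F : (κ → Y) → ℝ) :
    ∑ y : ι → Y, F (y ∘ φ) * ∏ i, w i (y i) = ∑ z : κ → Y, F z * ∏ j, w (φ j) (z j) := by
  classical
  have e1 : ∀ y : ι → Y, F (y ∘ φ) * ∏ i, w i (y i) =
      ∑ z : κ → Y, F z * if y ∘ φ = z then ∏ i, w i (y i) else 0 := fun y => by simp
  simp_rw [e1]
  rw [Finset.sum_comm]
  refine Finset.sum_congr rfl fun z _ => ?_
  rw [← Finset.mul_sum]
  congr 1
  -- The constraint `y ∘ φ = z` is split over the coordinates of `y`. Outside the range of `φ` the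
  -- condition is vacuous and the coordinate sums to `1`.
  have e2 : ∀ y : ι → Y, (if y ∘ φ = z then ∏ i, w i (y i) else 0) =
      ∏ i, if ∀ j, φ j = i → y i = z j then w i (y i) else 0 := by
    intro y
    by_cases h : y ∘ φ = z
    · rw [if_pos h]
      refine Finset.prod_congr rfl fun i _ => (if_pos fun j hj => ?_).symm
      rw [← hj, ← h]; rfl
    · rw [if_neg h]
      obtain ⟨j, hj⟩ := Function.ne_iff.1 h
      exact (Finset.prod_eq_zero (Finset.mem_univ (φ j)) (if_neg fun h' => hj (h' j rfl))).symm
  simp_rw [e2]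
  have h3 := Finset.prod_univ_sum (fun _ : ι => (Finset.univ : Finset Y))
    fun i y => if ∀ j, φ j = i → y = z j then w i y else 0
  rw [Fintype.piFinset_univ] at h3
  rw [← h3]
  refine (Fintype.prod_of_injective φ hφ _ _ (fun i hi => ?_) fun j => ?_).symm
  · rw [← hw i]
    refine Finset.sum_congr rfl fun y _ => if_pos fun j hj => absurd ⟨j, hj⟩ hi
  · have : ∀ y, (∀ j', φ j' = φ j → y = z j') ↔ y = z j := fun y =>
      ⟨fun h => h j rfl, fun h j' hj' => by rw [hφ hj', h]⟩
    simp [this]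

/-! ### Superposition codes by random coding with threshold decoding. -/

noncomputable section RandomCoding

open scoped Classical

lemma sum_prod_mul_eval {ι α : Type*} [Fintype ι] [Fintype α] {p : α → ℝ} (hp : ∑ a, p a = 1)
    (i : ι) (F : α → ℝ) :
    ∑ f : ι → α, (∏ j, p (f j)) * F (f i) = ∑ a, p a * F a := by
  have h := sum_comp_mul_prod (φ := fun _ : Unit => i) (fun _ _ _ => rfl) (fun _ => p)
    (fun _ => hp) fun z => F (z ())
  simp only [Function.comp_apply] at h
  simp_rw [mul_comm _ (F _)]
  rw [h, ← (Equiv.funUnique Unit α).sum_comp]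
  simp

lemma sum_prod_mul_eval₂ {ι α : Type*} [Fintype ι] [Fintype α] {p : α → ℝ} (hp : ∑ a, p a = 1)
    {i j : ι} (hij : i ≠ j) (F : α → α → ℝ) :
    ∑ f : ι → α, (∏ j, p (f j)) * F (f i) (f j) = ∑ a, ∑ b, p a * p b * F a b := by
  have hφ : Function.Injective ![i, j] := by
    intro a b; fin_cases a <;> fin_cases b <;> simp [hij, hij.symm]
  have h := sum_comp_mul_prod hφ (fun _ => p) (fun _ => hp) fun z => F (z 0) (z 1)
  simp only [Function.comp_apply, Matrix.cons_val_zero, Matrix.cons_val_one] at h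
  simp_rw [mul_comm _ (F _ _)]
  rw [h, ← (finTwoArrowEquiv α).symm.sum_comp, Fintype.sum_prod_type]
  simp [Fin.prod_univ_two]

/-- The positive weight matters: it puts the selected codebook in the support, where satellites lie
over their cloud centre. -/
lemma exists_le_of_sum_mul_le {α : Type*} [Fintype α] {w F : α → ℝ} {B : ℝ} (hw : ∀ a, 0 ≤ w a)
    (h1 : ∑ a, w a = 1) (h : ∑ a, w a * F a ≤ B) : ∃ a, 0 < w a ∧ F a ≤ B := by
  by_contra! hcon
  have h2 : ∀ a, w a * B ≤ w a * F a := fun a => by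
    rcases (hw a).eq_or_lt with h0 | h0
    · simp [← h0]
    · exact mul_le_mul_of_nonneg_left (hcon a h0).le h0.le
  obtain ⟨a, -, ha⟩ : ∃ a ∈ Finset.univ, 0 < w a := by
    by_contra! h3
    linarith [Finset.sum_nonpos h3]
  have h3 : ∑ a, w a * B < ∑ a, w a * F a :=
    Finset.sum_lt_sum (fun a _ => h2 a)
      ⟨a, Finset.mem_univ _, mul_lt_mul_of_pos_left (hcon a ha) ha⟩
  rw [← Finset.sum_mul, h1, one_mul] at h3
  linarith

variable {X Z C : Type*} [Fintype X]

/-- The conditional law of `x` given `g x = c`. It is `P` itself if that event has mass `0`. -/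
def condLaw (P : X → ℝ) (g : X → C) (c : C) (x : X) : ℝ :=
  if fiberMass P g c = 0 then P x else if g x = c then P x / fiberMass P g c else 0

variable {P : X → ℝ} {K : X → Z → ℝ} (g : X → C)

lemma condLaw_mem (hP : P ∈ stdSimplex ℝ X) (c : C) : condLaw P g c ∈ stdSimplex ℝ X := by
  by_cases h : fiberMass P g c = 0
  · convert hP using 1
    funext x; simp [condLaw, h]
  · have e : condLaw P g c = fun x => (if g x = c then P x else 0) / fiberMass P g c := by
      funext x; simp only [condLaw, h, if_false]; split_ifs <;> simp
    rw [e]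
    refine ⟨fun x => div_nonneg (by split_ifs <;> simp [hP.1]) (fiberMass_nonneg g hP.1 c), ?_⟩
    rw [← Finset.sum_div]
    exact div_self h

lemma fiberMass_mul_condLaw (hP : ∀ x, 0 ≤ P x) (c : C) (x : X) :
    fiberMass P g c * condLaw P g c x = if g x = c then P x else 0 := by
  by_cases h : fiberMass P g c = 0
  · rw [h, zero_mul]
    split_ifs with hx
    · subst hx
      exact le_antisymm (hP x) (h ▸ le_fiberMass g hP x)
    · rfl
  · simp only [condLaw, h, if_false]
    split_ifs
    · field_simp
    · simp

lemma sum_condLaw_mul {c : C} (h : fiberMass P g c ≠ 0) (z : Z) :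
    ∑ x, condLaw P g c x * K x z = condOut P K g c z := by
  simp only [condLaw, h, if_false, condOut]
  rw [Finset.sum_div]
  refine Finset.sum_congr rfl fun x _ => ?_
  split_ifs
  · ring
  · simp

lemma sum_fiberMass_mul [Fintype C] (hP : ∀ x, 0 ≤ P x) (F : C → X → ℝ) :
    ∑ c, fiberMass P g c * ∑ x, condLaw P g c x * F c x = ∑ x, P x * F (g x) x := by
  simp_rw [Finset.mul_sum, ← mul_assoc, fiberMass_mul_condLaw g hP]
  rw [Finset.sum_comm]
  simp

lemma sum_fiberMass [Fintype C] : ∑ c, fiberMass P g c = ∑ x, P x := by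
  unfold fiberMass
  rw [Finset.sum_comm]
  simp

variable [Fintype Z]

/-- The probability that the pair of an input `x` and an independent output with the law of the
outputs given `g x` passes the threshold test. -/
def hitMass (P : X → ℝ) (K : X → Z → ℝ) (g : X → C) (G : ℝ) : ℝ :=
  ∑ x, ∑ z, if G * condOut P K g (g x) z < K x z then P x * condOut P K g (g x) z else 0

/-- The probability that the output of the input `a` and the input `b` pass the threshold test. -/
def confusion (P : X → ℝ) (K : X → Z → ℝ) (g : X → C) (G : ℝ) (a b : X) : ℝ :=
  ∑ z, if G * condOut P K g (g b) z < K b z then K a z else 0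

/-- The probability that the input `a` and its output do not pass the threshold test. -/
def miss (P : X → ℝ) (K : X → Z → ℝ) (g : X → C) (G : ℝ) (a : X) : ℝ :=
  ∑ z, if K a z ≤ G * condOut P K g (g a) z then K a z else 0

lemma sum_mul_miss (G : ℝ) : ∑ x, P x * miss P K g G x = missMass P K g G := by
  simp [miss, missMass, Finset.mul_sum]

/-- On the event of passing the test, `G` times the averaged output law is below `K`, so `G` times
the mass is at most the total mass of `P x * K x z`. -/
lemma mul_hitMass_le_one (hP : P ∈ stdSimplex ℝ X) (hK : ∀ x, K x ∈ stdSimplex ℝ Z) (G : ℝ) :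
    G * hitMass P K g G ≤ 1 := by
  rw [← sum_sum_mul_eq_one hP hK, hitMass]
  simp_rw [Finset.mul_sum]
  refine Finset.sum_le_sum fun x _ => Finset.sum_le_sum fun z _ => ?_
  split_ifs with h
  · rw [mul_left_comm]
    exact mul_le_mul_of_nonneg_left h.le (hP.1 x)
  · rw [mul_zero]; exact mul_nonneg (hP.1 x) ((hK x).1 z)

lemma hitMass_nonneg (hP : P ∈ stdSimplex ℝ X) (hK : ∀ x, K x ∈ stdSimplex ℝ Z) (G : ℝ) :
    0 ≤ hitMass P K g G :=
  Finset.sum_nonneg fun x _ => Finset.sum_nonneg fun z _ => by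
    split_ifs
    · exact mul_nonneg (hP.1 x) (condOut_nonneg g hP.1 (fun x => (hK x).1) _ _)
    · rfl

lemma sum_condLaw_mul_confusion {c : C} (h : fiberMass P g c ≠ 0) (G : ℝ) (b : X) :
    ∑ a, condLaw P g c a * confusion P K g G a b =
      ∑ z, if G * condOut P K g (g b) z < K b z then condOut P K g c z else 0 := by
  simp_rw [confusion, Finset.mul_sum]
  rw [Finset.sum_comm]
  refine Finset.sum_congr rfl fun z _ => ?_
  split_ifs
  · exact sum_condLaw_mul g h z
  · simp

/-- Two satellites of one cloud are independent given its centre `c`. Averaging over the transmitted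
one turns its output law into `condOut` at `c`, which is the law the test for the other compares
with. -/
lemma sum_sum_condLaw_mul_confusion [Fintype C] (hP : P ∈ stdSimplex ℝ X) (G : ℝ) :
    ∑ c, fiberMass P g c * ∑ a, ∑ b, condLaw P g c a * condLaw P g c b * confusion P K g G a b =
      hitMass P K g G := by
  have e : ∀ c, fiberMass P g c *
      ∑ a, ∑ b, condLaw P g c a * condLaw P g c b * confusion P K g G a b =
      fiberMass P g c * ∑ b, condLaw P g c b *
        ∑ z, if G * condOut P K g (g b) z < K b z then condOut P K g c z else 0 := by
    intro c
    by_cases h : fiberMass P g c = 0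
    · simp [h]
    congr 1
    rw [Finset.sum_comm]
    refine Finset.sum_congr rfl fun b _ => ?_
    rw [← sum_condLaw_mul_confusion g h, Finset.mul_sum]
    exact Finset.sum_congr rfl fun a _ => by ring
  simp_rw [e]
  rw [sum_fiberMass_mul g hP.1 fun c b =>
    ∑ z, if G * condOut P K g (g b) z < K b z then condOut P K g c z else 0]
  simp [hitMass, Finset.mul_sum]

lemma sum_sum_mul_confusion (hP : P ∈ stdSimplex ℝ X) (G : ℝ) :
    ∑ a, ∑ b, P a * P b * confusion P K (fun _ => ()) G a b =
      hitMass P K (fun _ => ()) G := by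
  have h := sum_sum_condLaw_mul_confusion (K := K) (fun _ : X => ()) hP G
  have h1 : fiberMass P (fun _ => ()) () = 1 := by simp [fiberMass, hP.2]
  have h2 : condLaw P (fun _ => ()) () = P := by funext x; simp [condLaw, h1]
  rw [← h]
  simp [h1, h2]

/-- The law of a cloud centre together with a satellite codeword for each element of `J`. -/
def cloudLaw {J : Type*} [Fintype J] (P : X → ℝ) (g : X → C) (ω : C × (J → X)) : ℝ :=
  fiberMass P g ω.1 * ∏ j, condLaw P g ω.1 (ω.2 j)

lemma sum_cloudLaw_mul [Fintype C] {J : Type*} [Fintype J] (hP : P ∈ stdSimplex ℝ X) (j : J)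
    (F : X → ℝ) : ∑ ω : C × (J → X), cloudLaw P g ω * F (ω.2 j) = ∑ x, P x * F x := by
  rw [Fintype.sum_prod_type]
  simp_rw [cloudLaw, mul_assoc, ← Finset.mul_sum, sum_prod_mul_eval (condLaw_mem g hP _).2]
  exact sum_fiberMass_mul g hP.1 fun _ => F

lemma cloudLaw_mem [Fintype C] {J : Type*} [Fintype J] (hP : P ∈ stdSimplex ℝ X) :
    cloudLaw P g ∈ stdSimplex ℝ (C × (J → X)) := by
  refine ⟨fun ω => mul_nonneg (fiberMass_nonneg g hP.1 _)
    (Finset.prod_nonneg fun j _ => (condLaw_mem g hP _).1 _), ?_⟩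
  rw [Fintype.sum_prod_type]
  have h : ∀ c, ∑ y : J → X, ∏ j, condLaw P g c (y j) = 1 := fun c => by
    have := Finset.prod_univ_sum (fun _ : J => (Finset.univ : Finset X)) fun _ x => condLaw P g c x
    simp only [(condLaw_mem g hP c).2, Finset.prod_const_one, Fintype.piFinset_univ] at this
    exact this.symm
  simp_rw [cloudLaw, ← Finset.mul_sum, h, mul_one]
  rw [sum_fiberMass, hP.2]

lemma sum_cloudLaw_mul_confusion [Fintype C] {J : Type*} [Fintype J] (hP : P ∈ stdSimplex ℝ X)
    {i j : J} (hij : i ≠ j) (G : ℝ) :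
    ∑ ω : C × (J → X), cloudLaw P g ω * confusion P K g G (ω.2 i) (ω.2 j) =
      hitMass P K g G := by
  rw [Fintype.sum_prod_type]
  simp_rw [cloudLaw, mul_assoc, ← Finset.mul_sum]
  rw [← sum_sum_condLaw_mul_confusion g hP]
  refine Finset.sum_congr rfl fun c _ => ?_
  rw [sum_prod_mul_eval₂ (condLaw_mem g hP c).2 hij]

lemma sum_sum_cloudLaw_mul [Fintype C] {J : Type*} [Fintype J] (hP : P ∈ stdSimplex ℝ X)
    (i j : J) (F : X → X → ℝ) :
    ∑ ω : C × (J → X), ∑ ω' : C × (J → X), cloudLaw P g ω * cloudLaw P g ω' * F (ω.2 i) (ω'.2 j) =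
      ∑ a, ∑ b, P a * P b * F a b := by
  simp_rw [mul_assoc, ← Finset.mul_sum, sum_cloudLaw_mul g hP]
  exact sum_cloudLaw_mul g hP i fun a => ∑ b, P b * F a b

lemma sum_mul_sum_comm {α β : Type*} [Fintype α] (w : α → ℝ) (s : Finset β) (F : β → α → ℝ) :
    ∑ a, w a * ∑ b ∈ s, F b a = ∑ b ∈ s, ∑ a, w a * F b a := by
  simp_rw [Finset.mul_sum]
  exact Finset.sum_comm

variable {I J : Type*} [Fintype I] [Fintype J]

/-- The bound on the error probability of the message `(i, j)` for the threshold decoder. -/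
def lossBound (P : X → ℝ) (K : X → Z → ℝ) (g : X → C) (G₁ G₂ : ℝ) (e : I → J → X) (i : I) (j : J) :
    ℝ :=
  miss P K (fun _ => ()) G₁ (e i j) + miss P K g G₂ (e i j) +
    ((∑ m ∈ Finset.univ.erase i ×ˢ Finset.univ,
      confusion P K (fun _ => ()) G₁ (e i j) (e m.1 m.2)) +
    ∑ j' ∈ Finset.univ.erase j, confusion P K g G₂ (e i j) (e i j'))

/-- The decoder returns the unique message passing both tests. It errs only if the true message
fails a test or a wrong one passes both. A wrong first message is charged to the unconditional test,
a wrong second message alone to the test given `g`. -/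
lemma exists_decoder [Nonempty I] [Nonempty J] (hK : ∀ x, K x ∈ stdSimplex ℝ Z) (G₁ G₂ : ℝ)
    (e : I → J → X) :
    ∃ f : Z → I × J, ∀ i j,
      ∑ z with f z ≠ (i, j), K (e i j) z ≤ lossBound P K g G₁ G₂ e i j := by
  set T : I × J → Z → Prop := fun m z =>
    G₁ * condOut P K (fun _ => ()) () z < K (e m.1 m.2) z ∧
      G₂ * condOut P K g (g (e m.1 m.2)) z < K (e m.1 m.2) z with hT
  refine ⟨fun z => if h : ∃ m, T m z ∧ ∀ m', T m' z → m' = m then h.choose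
    else Classical.arbitrary _, fun i j => ?_⟩
  set f : Z → I × J := fun z => if h : ∃ m, T m z ∧ ∀ m', T m' z → m' = m then h.choose
    else Classical.arbitrary _ with hf
  have hwrong : ∀ z, f z ≠ (i, j) → ¬ T (i, j) z ∨ ∃ m, m ≠ (i, j) ∧ T m z := by
    intro z hz
    by_contra! hcon
    have hex : ∃ m, T m z ∧ ∀ m', T m' z → m' = m :=
      ⟨(i, j), hcon.1, fun m' h => by_contra fun h' => hcon.2 m' h' h⟩
    refine hz ?_
    simp only [hf, dif_pos hex]
    exact (hex.choose_spec.2 _ hcon.1).symm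
  have hK0 : ∀ x z, 0 ≤ K x z := fun x => (hK x).1
  simp only [lossBound, miss, confusion]
  rw [Finset.sum_comm (s := Finset.univ.erase i ×ˢ Finset.univ),
    Finset.sum_comm (s := Finset.univ.erase j), ← Finset.sum_add_distrib,
    ← Finset.sum_add_distrib, ← Finset.sum_add_distrib, Finset.sum_filter]
  refine Finset.sum_le_sum fun z _ => ?_
  have n1 : 0 ≤ if K (e i j) z ≤ G₁ * condOut P K (fun _ => ()) () z then K (e i j) z else 0 := by
    split_ifs <;> simp [hK0]
  have n2 : 0 ≤ if K (e i j) z ≤ G₂ * condOut P K g (g (e i j)) z then K (e i j) z else 0 := by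
    split_ifs <;> simp [hK0]
  have n3 : ∀ m ∈ Finset.univ.erase i ×ˢ (Finset.univ : Finset J),
      0 ≤ if G₁ * condOut P K (fun _ => ()) () z < K (e m.1 m.2) z then K (e i j) z else 0 :=
    fun m _ => by split_ifs <;> simp [hK0]
  have n4 : ∀ j' ∈ Finset.univ.erase j,
      0 ≤ if G₂ * condOut P K g (g (e i j')) z < K (e i j') z then K (e i j) z else 0 :=
    fun m _ => by split_ifs <;> simp [hK0]
  have s3 := Finset.sum_nonneg n3
  have s4 := Finset.sum_nonneg n4
  by_cases hz : f z ≠ (i, j)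
  swap
  · rw [if_neg hz]; positivity
  rw [if_pos hz]
  rcases hwrong z hz with h | ⟨m, hm, h1, h2⟩
  · rw [hT, not_and_or, not_lt, not_lt] at h
    rcases h with h | h
    · rw [if_pos h] at n1 ⊢; linarith
    · rw [if_pos h] at n2 ⊢; linarith
  · by_cases hi : m.1 = i
    · have hj : m.2 ≠ j := fun hj => hm (Prod.ext hi hj)
      have := Finset.single_le_sum n4 (Finset.mem_erase.2 ⟨hj, Finset.mem_univ _⟩)
      rw [hi] at h2
      rw [if_pos h2] at this
      linarith
    · have := Finset.single_le_sum n3 (Finset.mem_product.2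
        ⟨Finset.mem_erase.2 ⟨hi, Finset.mem_univ _⟩, Finset.mem_univ m.2⟩)
      rw [if_pos h1] at this
      linarith

/-- Superposition coding for a single use of a channel, by random coding: the cloud centre
`e₁ i` depends on the first message only. -/
theorem exists_superposition_code [Fintype C] [Nonempty I] [Nonempty J] (hP : P ∈ stdSimplex ℝ X)
    (hK : ∀ x, K x ∈ stdSimplex ℝ Z) {G₁ G₂ B₁ B₂ : ℝ} (hB₁ : 0 ≤ B₁) (hB₂ : 0 ≤ B₂)
    (h₁ : (Fintype.card I : ℝ) * Fintype.card J - 1 ≤ B₁ * G₁)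
    (h₂ : (Fintype.card J : ℝ) - 1 ≤ B₂ * G₂) :
    ∃ (e₁ : I → C) (e : I → J → X) (f : Z → I × J), (∀ i j, g (e i j) = e₁ i) ∧
      1 / ((Fintype.card I : ℝ) * Fintype.card J) * ∑ i, ∑ j, ∑ z with f z ≠ (i, j), K (e i j) z ≤
        missMass P K (fun _ => ()) G₁ + missMass P K g G₂ + (B₁ + B₂) := by
  have hI : 1 ≤ (Fintype.card I : ℝ) := by exact_mod_cast Fintype.card_pos
  have hJ : 1 ≤ (Fintype.card J : ℝ) := by exact_mod_cast Fintype.card_pos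
  set q : C × (J → X) → ℝ := cloudLaw P g with hq
  have hq1 : q ∈ stdSimplex ℝ _ := cloudLaw_mem g hP
  set w : (I → C × (J → X)) → ℝ := fun c => ∏ i, q (c i) with hw
  set B := missMass P K (fun _ => ()) G₁ + missMass P K g G₂ + (B₁ + B₂) with hB
  have hw1 : ∑ c, w c = 1 := by
    have := Finset.prod_univ_sum (fun _ : I => (Finset.univ : Finset (C × (J → X)))) fun _ ω => q ω
    simp only [hq1.2, Finset.prod_const_one, Fintype.piFinset_univ] at this
    exact this.symm
  have hone : ∀ i j (F : X → ℝ), ∑ c, w c * F ((c i).2 j) = ∑ x, P x * F x := fun i j F => by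
    rw [← sum_cloudLaw_mul g hP j]
    exact sum_prod_mul_eval hq1.2 i fun ω => F (ω.2 j)
  have hloss : ∀ i j, ∑ c, w c * lossBound P K g G₁ G₂ (fun i => (c i).2) i j ≤ B := by
    intro i j
    have t3 : ∀ m ∈ Finset.univ.erase i ×ˢ (Finset.univ : Finset J),
        ∑ c, w c * confusion P K (fun _ => ()) G₁ ((c i).2 j) ((c m.1).2 m.2) =
          hitMass P K (fun _ => ()) G₁ := by
      intro m hm
      have hne : i ≠ m.1 := (Finset.mem_erase.1 (Finset.mem_product.1 hm).1).1.symm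
      rw [← sum_sum_mul_confusion hP, ← sum_sum_cloudLaw_mul g hP j m.2]
      exact sum_prod_mul_eval₂ hq1.2 hne
        fun ω ω' => confusion P K (fun _ => ()) G₁ (ω.2 j) (ω'.2 m.2)
    have t4 : ∀ j' ∈ Finset.univ.erase j,
        ∑ c, w c * confusion P K g G₂ ((c i).2 j) ((c i).2 j') = hitMass P K g G₂ := by
      intro j' hj'
      rw [← sum_cloudLaw_mul_confusion g hP (Finset.mem_erase.1 hj').1.symm]
      exact sum_prod_mul_eval hq1.2 i fun ω => confusion P K g G₂ (ω.2 j) (ω.2 j')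
    have c3 : ((Finset.univ.erase i ×ˢ (Finset.univ : Finset J)).card : ℝ) =
        (Fintype.card I - 1) * Fintype.card J := by
      rw [Finset.card_product, Finset.card_erase_of_mem (Finset.mem_univ _), Finset.card_univ,
        Finset.card_univ, Nat.cast_mul, Nat.cast_sub Fintype.card_pos, Nat.cast_one]
    have c4 : ((Finset.univ.erase j).card : ℝ) = Fintype.card J - 1 := by
      rw [Finset.card_erase_of_mem (Finset.mem_univ _), Finset.card_univ,
        Nat.cast_sub Fintype.card_pos, Nat.cast_one]
    simp only [lossBound, mul_add, Finset.sum_add_distrib]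
    rw [hone i j fun x => miss P K (fun _ => ()) G₁ x, hone i j fun x => miss P K g G₂ x,
      sum_mul_miss, sum_mul_miss, sum_mul_sum_comm, sum_mul_sum_comm, Finset.sum_congr rfl t3,
      Finset.sum_congr rfl t4, Finset.sum_const, Finset.sum_const, nsmul_eq_mul, nsmul_eq_mul, c3,
      c4]
    have k1 := mul_hitMass_le_one (K := K) (fun _ => ()) hP hK G₁
    have k2 := mul_hitMass_le_one g hP hK G₂
    have p1 := hitMass_nonneg (K := K) (fun _ => ()) hP hK G₁
    have p2 := hitMass_nonneg g hP hK G₂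
    -- The `(|I| - 1) |J|` wrong pairs number at most `|I| |J| - 1`. Subtracting `1` in the
    -- hypotheses makes `B = G = 0` admissible for a single message.
    have b1 : ((Fintype.card I : ℝ) - 1) * Fintype.card J * hitMass P K (fun _ => ()) G₁ ≤ B₁ := by
      calc _ ≤ B₁ * G₁ * hitMass P K (fun _ => ()) G₁ :=
            mul_le_mul_of_nonneg_right (by linarith) p1
        _ ≤ B₁ * 1 := by rw [mul_assoc]; exact mul_le_mul_of_nonneg_left k1 hB₁
        _ = B₁ := mul_one _
    have b2 : ((Fintype.card J : ℝ) - 1) * hitMass P K g G₂ ≤ B₂ := by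
      calc _ ≤ B₂ * G₂ * hitMass P K g G₂ := mul_le_mul_of_nonneg_right h₂ p2
        _ ≤ B₂ * 1 := by rw [mul_assoc]; exact mul_le_mul_of_nonneg_left k2 hB₂
        _ = B₂ := mul_one _
    linarith
  obtain ⟨c, hc, hcB⟩ := exists_le_of_sum_mul_le (w := w)
    (F := fun c => 1 / ((Fintype.card I : ℝ) * Fintype.card J) *
      ∑ i, ∑ j, lossBound P K g G₁ G₂ (fun i => (c i).2) i j) (B := B)
    (fun c => Finset.prod_nonneg fun i _ => hq1.1 _) hw1 (by
      simp_rw [mul_left_comm (w _)]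
      rw [← Finset.mul_sum, sum_mul_sum_comm]
      simp_rw [sum_mul_sum_comm]
      rw [one_div_mul_eq_div, div_le_iff₀ (by positivity)]
      refine (Finset.sum_le_sum fun i _ => Finset.sum_le_sum fun j _ => hloss i j).trans_eq ?_
      simp only [Finset.sum_const, Finset.card_univ, nsmul_eq_mul]
      ring)
  obtain ⟨f, hf⟩ := exists_decoder (P := P) g hK G₁ G₂ fun i => (c i).2
  refine ⟨fun i => (c i).1, fun i => (c i).2, f, fun i j => ?_, le_trans ?_ hcB⟩
  · have h1 : q (c i) ≠ 0 := fun h0 => hc.ne' (Finset.prod_eq_zero (Finset.mem_univ i) h0)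
    rw [hq, cloudLaw] at h1
    have h2 := left_ne_zero_of_mul h1
    have h3 := Finset.prod_ne_zero_iff.1 (right_ne_zero_of_mul h1) j (Finset.mem_univ j)
    by_contra hne
    exact h3 (by simp [condLaw, h2, hne])
  · exact mul_le_mul_of_nonneg_left
      (Finset.sum_le_sum fun i _ => Finset.sum_le_sum fun j _ => hf i j) (by positivity)

end RandomCoding

/-! ### From codes to `regionR` and from `regionR` to `regionQ`. -/

section Region

lemma mem_closure_of_smul {A : Set (ℝ × ℝ)} {R : ℝ × ℝ}
    (h : ∀ t : ℝ, 0 < t → t < 1 → t • R ∈ A) : R ∈ closure A := by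
  have h1 : Tendsto (fun t : ℝ => t • R) (𝓝[<] 1) (𝓝 R) := by
    have : Tendsto (fun t : ℝ => t • R) (𝓝 1) (𝓝 ((1 : ℝ) • R)) :=
      (continuous_id.smul continuous_const).tendsto 1
    rw [one_smul] at this
    exact this.mono_left nhdsWithin_le_nhds
  refine mem_closure_of_tendsto h1 ?_
  filter_upwards [Ioo_mem_nhdsLT (zero_lt_one (α := ℝ))] with t ht
  exact h t ht.1 ht.2

/-- A bound on `J` that is asymptotically at least `n r` bits implies a rate of at least `t r`. -/
lemma eventually_mul_le {ε : ℕ → ℝ} (hε : Tendsto ε atTop (𝓝 0)) {t : ℝ} (ht : t < 1) {r : ℝ}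
    (hr : 0 ≤ r) (c : ℝ) :
    ∀ᶠ n : ℕ in atTop, ∀ J : ℝ, 0 ≤ J → (1 - ε n) * (n * r * Real.log 2) - c ≤ J →
      t * r ≤ 1 / (n : ℝ) * (J / Real.log 2) := by
  have hl : 0 < Real.log 2 := Real.log_pos one_lt_two
  -- For `r = 0` the constant `c` is not absorbed, and `0 ≤ J` is needed instead.
  rcases hr.eq_or_lt with rfl | hr
  · exact Eventually.of_forall fun n J hJ _ => by rw [mul_zero]; positivity
  have h1 : Tendsto (fun n : ℕ => 1 - ε n - t) atTop (𝓝 (1 - t)) := by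
    simpa using (hε.const_sub 1).sub_const t
  have h2 := h1.pos_mul_atTop (sub_pos.2 ht)
    (tendsto_natCast_atTop_atTop.atTop_mul_const (mul_pos hr hl))
  filter_upwards [h2.eventually_ge_atTop c, eventually_gt_atTop 0] with n h3 hn J _ hJ
  have hn' : (0 : ℝ) < n := by exact_mod_cast hn
  rw [one_div_mul_eq_div, le_div_iff₀ hn', le_div_iff₀ hl]
  nlinarith

lemma ceil_pos (n : ℕ) (r : ℝ) : 0 < ⌈(2 : ℝ) ^ ((n : ℝ) * r)⌉₊ := Nat.ceil_pos.2 (by positivity)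

lemma mul_log_le_log_ceil (n : ℕ) (r : ℝ) :
    n * r * Real.log 2 ≤ Real.log (⌈(2 : ℝ) ^ ((n : ℝ) * r)⌉₊ : ℝ) := by
  rw [← Real.log_rpow two_pos]
  exact Real.log_le_log (by positivity) (Nat.le_ceil _)

/-- For each first message the decoding sets of the second messages are disjoint, so they carry
total mass at most `1`. This is the count behind Fano's inequality given the first word. -/
lemma sum_fin_prod_filter_le {M₁ M₂ : ℕ} {Z : Type*} [Fintype Z] (f : Z → Fin M₁ × Fin M₂)
    {Q : Fin M₁ → Z → ℝ} (hQ : ∀ m z, 0 ≤ Q m z) (hQ1 : ∀ m, ∑ z, Q m z ≤ 1) :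
    ∑ m : Fin M₁ × Fin M₂, ∑ z with f z = m, Q m.1 z ≤ M₁ := by
  rw [Fintype.sum_prod_type]
  have h : ∀ m₁ : Fin M₁, ∑ m₂ : Fin M₂, ∑ z with f z = (m₁, m₂), Q m₁ z ≤ 1 := by
    intro m₁
    refine le_trans ?_ (hQ1 m₁)
    rw [← Finset.sum_fiberwise Finset.univ (fun z => (f z).2) (Q m₁)]
    refine Finset.sum_le_sum fun m₂ _ => Finset.sum_le_sum_of_subset_of_nonneg ?_
      fun z _ _ => hQ m₁ z
    intro z
    simp only [Finset.mem_filter, Finset.mem_univ, true_and]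
    exact fun hz => by rw [hz]
  refine (Finset.sum_le_sum fun m₁ _ => h m₁).trans_eq ?_
  simp

variable {X₁ X₂ Y : Type*} {dmin dmax : ℕ} {W : X₁ → X₂ → Y → ℝ}

lemma extend_of_lt {n : ℕ} (b : ℤ → X₁) (x : Fin n → X₁) (i : Fin n) {l : ℤ} (h : l = i) :
    extend b x l = x i := by
  subst h
  rw [extend, dif_pos ⟨by omega, by exact_mod_cast i.2⟩]
  simp

lemma shift_coe {n : ℕ} (d : Delay dmin dmax) (i : Core dmin dmax n) :
    ((shift d i : Fin n) : ℤ) = (i.1 : ℤ) - d.1 := by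
  have h1 := Finset.mem_Icc.mp d.2
  have h2 := i.2
  simp only [shift]
  omega

lemma le_card_core (n : ℕ) : n ≤ Fintype.card (Core dmin dmax n) + (dmin + dmax) := by
  have h : Function.Injective (fun j : Fin (n - (dmin + dmax)) =>
      (⟨⟨j + dmax, by omega⟩, by simp; omega⟩ : Core dmin dmax n)) := by
    intro a b hab
    simp only [Subtype.mk.injEq, Fin.mk.injEq] at hab
    omega
  have : _ ≤ Fintype.card (Core dmin dmax n) := Fintype.card_le_of_injective _ h
  rw [Fintype.card_fin] at this
  omega

variable [Fintype Y]

lemma prod_mem_stdSimplex {ι : Type*} [Fintype ι] [DecidableEq ι] {w : ι → Y → ℝ}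
    (hw : ∀ i, w i ∈ stdSimplex ℝ Y) : (fun y : ι → Y => ∏ i, w i (y i)) ∈ stdSimplex ℝ (ι → Y) := by
  refine ⟨fun y => Finset.prod_nonneg fun i _ => (hw i).1 _, ?_⟩
  have := Finset.prod_univ_sum (fun _ : ι => (Finset.univ : Finset Y)) w
  simp only [(hw _).2, Finset.prod_const_one, Fintype.piFinset_univ] at this
  exact this.symm

lemma law_mem (hW : ∀ x₁ x₂, W x₁ x₂ ∈ stdSimplex ℝ Y) {n : ℕ} (d : ℤ) (b : ℤ → X₁)
    (x₁ : Fin n → X₁) (x₂ : Fin n → X₂) : law W d b x₁ x₂ ∈ stdSimplex ℝ (Fin n → Y) :=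
  prod_mem_stdSimplex fun _ => hW _ _

lemma coreLaw_mem (hW : ∀ x₁ x₂, W x₁ x₂ ∈ stdSimplex ℝ Y) {n : ℕ} (d : Delay dmin dmax)
    (x₁ : Fin n → X₁) (x₂ : Fin n → X₂) :
    coreLaw W d x₁ x₂ ∈ stdSimplex ℝ (Core dmin dmax n → Y) :=
  prod_mem_stdSimplex fun _ => hW _ _

variable [Fintype X₁] [Fintype X₂]

lemma ratePairs_iff {Z : Type*} [Fintype Z] {n : ℕ} {P : (Fin n → X₁) × (Fin n → X₂) → ℝ}
    {K : (Fin n → X₁) → (Fin n → X₂) → Z → ℝ} (hP : P ∈ stdSimplex ℝ _)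
    (hK : ∀ x₁ x₂, K x₁ x₂ ∈ stdSimplex ℝ Z) (R : ℝ × ℝ) :
    R ∈ ratePairs P K ↔ 0 ≤ R.1 ∧ 0 ≤ R.2 ∧
      R.1 + R.2 ≤ 1 / (n : ℝ) * (condInfo P (fun x => K x.1 x.2) (fun _ => ()) / Real.log 2) ∧
      R.2 ≤ 1 / (n : ℝ) * (condInfo P (fun x => K x.1 x.2) Prod.fst / Real.log 2) := by
  rw [← mutualInfo_eq hP fun x => hK x.1 x.2, ← condMutualInfo_eq fun x => hK x.1 x.2]
  rfl

lemma smul_mem_ratePairs {Z : Type*} [Fintype Z] {n : ℕ} {P : (Fin n → X₁) × (Fin n → X₂) → ℝ}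
    {K : (Fin n → X₁) → (Fin n → X₂) → Z → ℝ} (hP : P ∈ stdSimplex ℝ _)
    (hK : ∀ x₁ x₂, K x₁ x₂ ∈ stdSimplex ℝ Z) {R : ℝ × ℝ} {t : ℝ} (ht : 0 ≤ t) (h1 : 0 ≤ R.1)
    (h2 : 0 ≤ R.2)
    (h3 : t * (R.1 + R.2) ≤
      1 / (n : ℝ) * (condInfo P (fun x => K x.1 x.2) (fun _ => ()) / Real.log 2))
    (h4 : t * R.2 ≤ 1 / (n : ℝ) * (condInfo P (fun x => K x.1 x.2) Prod.fst / Real.log 2)) :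
    t • R ∈ ratePairs P K := by
  rw [ratePairs_iff hP hK]
  refine ⟨mul_nonneg ht h1, mul_nonneg ht h2, ?_, h4⟩
  simpa [mul_add] using h3

/-! ### The converse -/

/-- Fano's inequality with `c = M₁ M₂` for constant `g`, and with `c = M₂` for `Prod.fst`: given the
first codeword, the decoding mass sums to at most `M₁`, that is, the number of messages divided by
`M₂`. -/
lemma fano_errorProb (hW : ∀ x₁ x₂, W x₁ x₂ ∈ stdSimplex ℝ Y) {M₁ M₂ n : ℕ} (hM₁ : 0 < M₁)
    (hM₂ : 0 < M₂) (c : Code X₁ X₂ Y M₁ M₂ n) (d : ℤ) (b : ℤ → X₁) :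
    (1 - errorProb W c d b) * Real.log (M₁ * M₂) - 1 ≤
      condInfo (codewordLaw fun m : Fin M₁ × Fin M₂ => (c.enc₁ m.1, c.enc₂ m.1 m.2))
        (fun x => law W d b x.1 x.2) (fun _ => ()) ∧
    (1 - errorProb W c d b) * Real.log M₂ - 1 ≤
      condInfo (codewordLaw fun m : Fin M₁ × Fin M₂ => (c.enc₁ m.1, c.enc₂ m.1 m.2))
        (fun x => law W d b x.1 x.2) Prod.fst := by
  have : Nonempty (Fin M₁ × Fin M₂) := ⟨(⟨0, hM₁⟩, ⟨0, hM₂⟩)⟩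
  set e : Fin M₁ × Fin M₂ → (Fin n → X₁) × (Fin n → X₂) :=
    fun m => (c.enc₁ m.1, c.enc₂ m.1 m.2) with he
  have hP := codewordLaw_mem e
  have hcard : (Fintype.card (Fin M₁ × Fin M₂) : ℝ) = M₁ * M₂ := by simp
  have hK : ∀ x : (Fin n → X₁) × (Fin n → X₂), law W d b x.1 x.2 ∈ stdSimplex ℝ _ :=
    fun x => law_mem hW _ _ _ _
  have herr : errorProb W c d b = 1 / (Fintype.card (Fin M₁ × Fin M₂) : ℝ) *
      ∑ m, ∑ z with c.dec z ≠ m, law W d b (e m).1 (e m).2 z := by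
    rw [hcard, Fintype.sum_prod_type]; rfl
  refine ⟨fano (fun _ => ()) e c.dec (by positivity) hK herr ?_,
    fano Prod.fst e c.dec (by positivity) hK herr ?_⟩
  · rw [hcard]
    refine mul_le_of_le_one_right (by positivity) ?_
    rw [Finset.sum_fiberwise Finset.univ c.dec]
    exact sum_condOut_le_one _ hK _
  · rw [hcard, mul_comm]
    refine mul_le_mul_of_nonneg_right ?_ (by positivity)
    exact sum_fin_prod_filter_le c.dec
      (Q := fun m z => condOut (codewordLaw e) (fun x => law W d b x.1 x.2) Prod.fst
        (c.enc₁ m) z)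
      (fun m z => condOut_nonneg _ hP.1 (fun x => (hK x).1) _ _)
      (fun m => sum_condOut_le_one _ hK _)

lemma Achievable.eventually_smul_mem (hW : ∀ x₁ x₂, W x₁ x₂ ∈ stdSimplex ℝ Y)
    {E : ℕ → Delay dmin dmax → Set (ℤ → X₁)} {R : ℝ × ℝ} (hR : Achievable W E R) {t : ℝ}
    (ht : 0 < t) (ht1 : t < 1) : ∀ᶠ n in atTop, t • R ∈ regionR W E n := by
  obtain ⟨h1, h2, ε, hε, hcode⟩ := hR
  filter_upwards [eventually_mul_le hε ht1 (add_nonneg h1 h2) 1, eventually_mul_le hε ht1 h2 1,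
    hε.eventually_le_const one_pos] with n ha hb hε1
  obtain ⟨c, hc⟩ := hcode n
  have p1 := ceil_pos n R.1
  have p2 := ceil_pos n R.2
  have : Nonempty (Fin ⌈(2 : ℝ) ^ ((n : ℝ) * R.1)⌉₊ × Fin ⌈(2 : ℝ) ^ ((n : ℝ) * R.2)⌉₊) :=
    ⟨(⟨0, p1⟩, ⟨0, p2⟩)⟩
  simp only [regionR, Set.mem_iUnion, Set.mem_iInter]
  refine ⟨codewordLaw fun m : Fin _ × Fin _ => (c.enc₁ m.1, c.enc₂ m.1 m.2), codewordLaw_mem _, fun d b hb' => ?_⟩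
  obtain ⟨f1, f2⟩ := fano_errorProb hW p1 p2 c d b
  have hle := hc d b hb'
  have hl1 := mul_log_le_log_ceil n R.1
  have hl2 := mul_log_le_log_ceil n R.2
  have hl : (0 : ℝ) ≤ Real.log 2 := Real.log_nonneg one_le_two
  -- `ε n ≤ 1` keeps the factor `1 - ε n` nonnegative, so that replacing the logarithm of the
  -- message count by its lower bound goes the right way.
  have step : ∀ r L : ℝ, 0 ≤ r → n * r * Real.log 2 ≤ L →
      (1 - ε n) * (n * r * Real.log 2) - 1 ≤ (1 - errorProb W c d b) * L - 1 := by
    intro r L hr hL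
    have : 0 ≤ n * r * Real.log 2 := by positivity
    have h5 := mul_le_mul_of_nonneg_left hL (sub_nonneg.2 hε1)
    have h6 := mul_le_mul_of_nonneg_right (sub_le_sub_left hle 1) (this.trans hL)
    linarith
  refine smul_mem_ratePairs (codewordLaw_mem _) (fun _ _ => law_mem hW _ _ _ _) ht.le h1 h2
    (ha _ (condInfo_nonneg _ (codewordLaw_mem _) fun _ => law_mem hW _ _ _ _)
      ((step _ _ (add_nonneg h1 h2) ?_).trans f1))
    (hb _ (condInfo_nonneg _ (codewordLaw_mem _) fun _ => law_mem hW _ _ _ _)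
      ((step _ _ h2 hl2).trans f2))
  rw [Real.log_mul (Nat.cast_pos.2 p1).ne' (Nat.cast_pos.2 p2).ne']
  linarith

/-! ### Edge effects -/

lemma condInfo_law_le {C : Type*} (hW : ∀ x₁ x₂, W x₁ x₂ ∈ stdSimplex ℝ Y) [Nonempty Y] {n : ℕ}
    {P : (Fin n → X₁) × (Fin n → X₂) → ℝ} (hP : P ∈ stdSimplex ℝ _) (d : Delay dmin dmax)
    (b : ℤ → X₁) (g : (Fin n → X₁) × (Fin n → X₂) → C) :
    condInfo P (fun x => law W (d : ℤ) b x.1 x.2) g ≤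
      condInfo P (fun x => coreLaw W d x.1 x.2) g +
        Real.log ((Fintype.card Y : ℝ) ^ (dmin + dmax)) := by
  have hY : 1 ≤ (Fintype.card Y : ℝ) := by exact_mod_cast Fintype.card_pos
  have hext : ∀ (x : Fin n → X₁) (i : Core dmin dmax n),
      extend b x ((i.1 : ℤ) - d) = x (shift d i) := fun x i =>
    extend_of_lt b x _ (shift_coe d i).symm
  refine condInfo_le_add_log g (π := fun y => y ∘ Subtype.val) hP (fun _ => law_mem hW _ _ _ _)
    (fun _ => coreLaw_mem hW _ _ _) (fun x F => ?_) (fun x y => ?_) (by positivity) fun F hF => ?_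
  · have h := sum_comp_mul_prod (Subtype.val_injective (p := fun i : Fin n =>
      dmax ≤ (i : ℕ) ∧ (i : ℕ) + dmin < n))
      (fun i => W (extend b x.1 ((i : ℤ) - d)) (x.2 i)) (fun i => (hW _ _).2) F
    simp only [hext] at h
    exact h
  · have hle1 : ∀ i : Fin n, W (extend b x.1 ((i : ℤ) - d)) (x.2 i) (y i) ≤ 1 := fun i => by
      rw [← (hW (extend b x.1 ((i : ℤ) - d)) (x.2 i)).2]
      exact Finset.single_le_sum (fun y _ => (hW _ _).1 y) (Finset.mem_univ _)
    have h : ∏ i : Core dmin dmax n, W (x.1 (shift d i)) (x.2 i.1) (y i.1) =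
        ∏ i ∈ Finset.univ.filter (fun i : Fin n => dmax ≤ (i : ℕ) ∧ (i : ℕ) + dmin < n),
          W (extend b x.1 ((i : ℤ) - d)) (x.2 i) (y i) := by
      simp only [← hext x.1]
      exact (Finset.prod_subtype (Finset.univ.filter
        (fun i : Fin n => dmax ≤ (i : ℕ) ∧ (i : ℕ) + dmin < n)) (fun i => by simp)
        (fun i => W (extend b x.1 ((i : ℤ) - d)) (x.2 i) (y i))).symm
    simp only [law, coreLaw, Function.comp_apply]
    rw [h, ← Finset.prod_filter_mul_prod_filter_not Finset.univ
      (fun i : Fin n => dmax ≤ (i : ℕ) ∧ (i : ℕ) + dmin < n)]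
    exact mul_le_of_le_one_right (Finset.prod_nonneg fun i _ => (hW _ _).1 _)
      (Finset.prod_le_one (fun i _ => (hW _ _).1 _) fun i _ => hle1 i)
  -- The marginal formula for the uniform law on `Y` counts the fibres of the restriction to the
  -- core.
  · have h := sum_comp_mul_prod (Subtype.val_injective (p := fun i : Fin n =>
      dmax ≤ (i : ℕ) ∧ (i : ℕ) + dmin < n))
      (fun _ _ => 1 / (Fintype.card Y : ℝ)) (fun i => by simp) F
    simp only [Finset.prod_const, Finset.card_univ, Fintype.card_fin, ← Finset.sum_mul] at h
    have hs : 0 ≤ ∑ z, F z := Finset.sum_nonneg fun z _ => hF z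
    have hpow : (Fintype.card Y : ℝ) ^ n ≤ (Fintype.card Y : ℝ) ^ (dmin + dmax) *
        (Fintype.card Y : ℝ) ^ Fintype.card (Core dmin dmax n) := by
      rw [← pow_add, add_comm]
      exact pow_le_pow_right₀ hY (le_card_core n)
    rw [one_div_pow, one_div_pow, mul_one_div, mul_one_div, div_eq_div_iff (by positivity)
      (by positivity)] at h
    refine le_of_mul_le_mul_right ?_
      (show 0 < (Fintype.card Y : ℝ) ^ Fintype.card (Core dmin dmax n) by positivity)
    rw [h]
    calc _ ≤ (∑ z, F z) * _ := mul_le_mul_of_nonneg_left hpow hs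
      _ = _ := by ring

/-- The same `P` works: the loss `L` does not depend on `n`, so a single large `n` among the
infinitely many with `R` in `regionR` suffices. Nonemptiness of `E n d` supplies one edge assignment
for each delay. -/
lemma exists_smul_mem_regionQ (hW : ∀ x₁ x₂, W x₁ x₂ ∈ stdSimplex ℝ Y)
    {E : ℕ → Delay dmin dmax → Set (ℤ → X₁)} (hE : ∀ n d, (E n d).Nonempty) {R : ℝ × ℝ}
    (hR : ∃ᶠ n in atTop, R ∈ regionR W E n) {t : ℝ} (ht : 0 < t) (ht1 : t < 1) :
    ∃ n ≥ dmin + dmax + 1, t • R ∈ regionQ W dmin dmax n := by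
  set L := Real.log ((Fintype.card Y : ℝ) ^ (dmin + dmax)) with hL
  have hd0 : (0 : ℤ) ∈ Finset.Icc (-(dmin : ℤ)) (dmax : ℤ) := by simp
  have hmem : ∀ n, R ∈ regionR W E n → ∃ P ∈ stdSimplex ℝ ((Fin n → X₁) × (Fin n → X₂)),
      ∀ d : Delay dmin dmax, ∀ b ∈ E n d, R ∈ ratePairs P (law W (d : ℤ) b) := by
    intro n hn
    simpa only [regionR, Set.mem_iUnion, Set.mem_iInter, exists_prop] using hn
  have hnn : 0 ≤ R.1 ∧ 0 ≤ R.2 := by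
    obtain ⟨n, hn⟩ := hR.exists
    obtain ⟨P, -, h⟩ := hmem n hn
    obtain ⟨b, hb⟩ := hE n ⟨0, hd0⟩
    exact ⟨(h _ b hb).1, (h _ b hb).2.1⟩
  obtain ⟨h1, h2⟩ := hnn
  obtain ⟨n, hn, ⟨ha, hb⟩, hnD⟩ := (hR.and_eventually
    (((eventually_mul_le tendsto_const_nhds ht1 (add_nonneg h1 h2) L).and
      (eventually_mul_le tendsto_const_nhds ht1 h2 L)).and
        (eventually_ge_atTop (dmin + dmax + 1)))).exists
  refine ⟨n, hnD, ?_⟩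
  obtain ⟨P, hP, h⟩ := hmem n hn
  have hn0 : (0 : ℝ) < n := by exact_mod_cast (by omega : 0 < n)
  have hl : 0 < Real.log 2 := Real.log_pos one_lt_two
  have : Nonempty Y := by
    obtain ⟨x, -⟩ : (Finset.univ : Finset ((Fin n → X₁) × (Fin n → X₂))).Nonempty := by
      by_contra hempty
      have := hP.2
      rw [Finset.not_nonempty_iff_eq_empty.1 hempty] at this
      simp at this
    by_contra hY
    rw [not_nonempty_iff] at hY
    have := (hW (x.1 ⟨0, by omega⟩) (x.2 ⟨0, by omega⟩)).2
    simp at this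
  simp only [regionQ, Set.mem_iUnion, Set.mem_iInter]
  refine ⟨P, hP, fun d => ?_⟩
  obtain ⟨b, hb'⟩ := hE n d
  obtain ⟨-, -, h3, h4⟩ := (ratePairs_iff hP (fun _ _ => law_mem hW _ _ _ _) R).1 (h d b hb')
  rw [one_div_mul_eq_div, le_div_iff₀ hn0, le_div_iff₀ hl] at h3 h4
  have hK : ∀ x : (Fin n → X₁) × (Fin n → X₂), coreLaw W d x.1 x.2 ∈ stdSimplex ℝ _ :=
    fun x => coreLaw_mem hW d _ _
  have k1 := condInfo_law_le hW hP d b fun _ => ()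
  have k2 := condInfo_law_le hW hP d b Prod.fst
  refine smul_mem_ratePairs hP (fun _ _ => coreLaw_mem hW d _ _) ht.le h1 h2
    (ha _ (condInfo_nonneg _ hP hK) ?_) (hb _ (condInfo_nonneg _ hP hK) ?_)
  · linarith
  · linarith

end Region

/-! ### Coding over sub-blocks, uniformly in the delay. -/

section Achievability

/-- The concatenation of `k` words of length `n`, padded to the length `N`. -/
def concat {α : Type*} {n k : ℕ} (N : ℕ) (hn : 0 < n) (a : α) (u : Fin k → Fin n → α) :
    Fin N → α :=
  fun t => if h : (t : ℕ) / n < k then u ⟨t / n, h⟩ ⟨t % n, Nat.mod_lt _ hn⟩ else a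

lemma mul_add_lt_of_le {n k N : ℕ} (hN : k * n ≤ N) (j : Fin k) (i : Fin n) :
    (j : ℕ) * n + i < N := by
  have h1 : ((j : ℕ) + 1) * n ≤ k * n := Nat.mul_le_mul_right n j.2
  have := i.2
  rw [add_mul, one_mul] at h1
  omega

/-- The position in the block of the instant `i` of the sub-block `j`. -/
def position {n k N : ℕ} (hN : k * n ≤ N) (j : Fin k) (i : Fin n) : Fin N :=
  ⟨j * n + i, mul_add_lt_of_le hN j i⟩

lemma concat_position {α : Type*} {n k N : ℕ} (hN : k * n ≤ N) (hn : 0 < n) (a : α)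
    (u : Fin k → Fin n → α) (j : Fin k) (i : Fin n) :
    concat N hn a u (position hN j i) = u j i := by
  have h1 : ((j : ℕ) * n + i) / n = j := by
    rw [mul_comm, Nat.mul_add_div hn, Nat.div_eq_of_lt i.2, add_zero]
  have h2 : ((j : ℕ) * n + i) % n = i := by
    rw [mul_comm, Nat.mul_add_mod, Nat.mod_eq_of_lt i.2]
  simp [concat, position, h1, h2]

lemma position_injective {n k N : ℕ} (hN : k * n ≤ N) {j j' : Fin k} {i i' : Fin n}
    (h : position hN j i = position hN j' i') : j = j' ∧ i = i' := by
  have hn : 0 < n := i.pos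
  -- Concatenating the words that list their own indices gives a left inverse of `position`.
  have h1 := concat_position hN hn (j, i) (fun j i => (j, i)) j i
  rw [h, concat_position] at h1
  exact ⟨(Prod.ext_iff.1 h1).1.symm, (Prod.ext_iff.1 h1).2.symm⟩

variable {X₁ X₂ Y : Type*} [Fintype Y] {dmin dmax : ℕ}
  {W : X₁ → X₂ → Y → ℝ}

/-- A code for the memoryless channel formed by the core outputs of sub-blocks is a code for the
channel with delay, with the same error probability, whatever the edge symbols are. -/
lemma exists_code_errorProb_eq (hW : ∀ x₁ x₂, W x₁ x₂ ∈ stdSimplex ℝ Y) {n k N M₁ M₂ : ℕ}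
    (hn : 0 < n) (hN : k * n ≤ N) [Nonempty X₁] [Nonempty X₂] (e₁ : Fin M₁ → Fin k → Fin n → X₁)
    (e₂ : Fin M₁ → Fin M₂ → Fin k → Fin n → X₂)
    (f : (Fin k → Core dmin dmax n → Y) → Fin M₁ × Fin M₂) :
    ∃ c : Code X₁ X₂ Y M₁ M₂ N, ∀ (d : Delay dmin dmax) (b : ℤ → X₁),
      errorProb W c d b = 1 / ((M₁ : ℝ) * M₂) * ∑ m₁, ∑ m₂, ∑ z with f z ≠ (m₁, m₂),
        ∏ j, coreLaw W d (e₁ m₁ j) (e₂ m₁ m₂ j) (z j) := by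
  refine ⟨⟨fun m₁ => concat N hn (Classical.arbitrary X₁) (e₁ m₁),
    fun m₁ m₂ => concat N hn (Classical.arbitrary X₂) (e₂ m₁ m₂),
    fun y => f fun j i => y (position hN j i.1)⟩, fun d b => ?_⟩
  unfold errorProb
  congr 1
  refine Finset.sum_congr rfl fun m₁ _ => Finset.sum_congr rfl fun m₂ _ => ?_
  set φ : Fin k × Core dmin dmax n → Fin N := fun p => position hN p.1 p.2.1 with hφ
  have hinj : Function.Injective φ := fun p p' h =>
    Prod.ext (position_injective hN h).1 (Subtype.ext (position_injective hN h).2)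
  set x₁ := concat N hn (Classical.arbitrary X₁) (e₁ m₁) with hx₁
  set x₂ := concat N hn (Classical.arbitrary X₂) (e₂ m₁ m₂) with hx₂
  have h := sum_comp_mul_prod hinj (fun t => W (extend b x₁ ((t : ℤ) - d)) (x₂ t))
    (fun t => (hW _ _).2) fun z => if f (fun j i => z (j, i)) ≠ (m₁, m₂) then 1 else 0
  rw [Finset.sum_filter, Finset.sum_filter]
  simp only [ite_mul, one_mul, zero_mul, Function.comp_apply] at h
  refine Eq.trans h ?_
  rw [← (Equiv.curry (Fin k) (Core dmin dmax n) Y).symm.sum_comp]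
  refine Finset.sum_congr rfl fun z _ => if_congr Iff.rfl ?_ rfl
  rw [Fintype.prod_prod_type]
  refine Finset.prod_congr rfl fun j _ => Finset.prod_congr rfl fun i _ => ?_
  -- For a core instant `i`, the delayed instant `i - d` stays in sub-block `j`, so neither edge
  -- symbols nor neighbouring sub-blocks enter.
  have e1 : extend b x₁ ((φ (j, i) : ℤ) - d) = e₁ m₁ j (shift d i) := by
    rw [extend_of_lt b x₁ (position hN j (shift d i)), hx₁, concat_position]
    have := shift_coe d i
    simp only [hφ, position]
    push_cast
    linarith
  have e2 : x₂ (φ (j, i)) = e₂ m₁ m₂ j i.1 := concat_position _ _ _ _ _ _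
  rw [e1, e2]
  rfl

lemma missMass_of_subsingleton {X Z C C' : Type*} [Fintype X] [Fintype Z] [Subsingleton C]
    [Subsingleton C'] {P : X → ℝ} (hP : P ∈ stdSimplex ℝ X) (K : X → Z → ℝ) (g : X → C)
    (g' : X → C') (G : ℝ) : missMass P K g G = missMass P K g' G := by
  simp only [missMass, condOut_of_subsingleton _ hP]

/-- If the message count grows at exponent `γ`, the threshold takes an exponent `γ'` strictly
between `γ` and the smallest information: wrong messages then pass rarely and the true one almost
surely. If there is at most one message, `G = B = 0` will do. -/
lemma exists_thresholds {S X Z C : Type*} [Fintype S] [Nonempty S] [Fintype X] [Fintype Z]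
    {P : X → ℝ} {K : S → X → Z → ℝ} (g : X → C) (hP : P ∈ stdSimplex ℝ X)
    (hK : ∀ s x, K s x ∈ stdSimplex ℝ Z) {κ : ℕ → ℕ} (hκ : Tendsto κ atTop atTop) {M : ℕ → ℝ}
    (hM : (∀ N, M N ≤ 1) ∨ ∃ γ A : ℝ, 0 ≤ A ∧ (∀ s, γ < condInfo P (K s) g) ∧
      ∀ N, M N ≤ A * Real.exp (γ * κ N)) :
    ∃ G B : ℕ → ℝ, (∀ N, 0 ≤ B N) ∧ (∀ N, M N - 1 ≤ B N * G N) ∧ Tendsto B atTop (𝓝 0) ∧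
      Tendsto (fun N => missMass (powLaw P (κ N)) (mixture fun s => powChannel (K s) (κ N))
        (fun x j => g (x j)) (G N)) atTop (𝓝 0) := by
  rcases hM with hM | ⟨γ, A, hA, hγ, hM⟩
  · refine ⟨fun _ => 0, fun _ => 0, fun _ => le_rfl, fun N => by simpa using hM N,
      tendsto_const_nhds, ?_⟩
    have : ∀ N, missMass (powLaw P (κ N)) (mixture fun s => powChannel (K s) (κ N))
        (fun x j => g (x j)) 0 = 0 := fun N => missMass_zero _ fun x =>
      (mixture_mem (fun s => powChannel_mem (hK s) (κ N)) x).1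
    simp [this]
  · obtain ⟨s₀, hs₀⟩ := Finite.exists_min fun s => condInfo P (K s) g
    obtain ⟨γ', h1, h2⟩ := exists_between (hγ s₀)
    refine ⟨fun N => Real.exp (γ' * κ N), fun N => A * Real.exp ((γ - γ') * κ N),
      fun N => by positivity, fun N => ?_, ?_, ?_⟩
    · rw [mul_assoc, ← Real.exp_add, ← add_mul, sub_add_cancel]
      linarith [hM N]
    · have h3 : Tendsto (fun N => (γ - γ') * (κ N : ℝ)) atTop atBot :=
        (tendsto_natCast_atTop_atTop.comp hκ).const_mul_atTop_of_neg (sub_neg.2 h1)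
      simpa using (Real.tendsto_exp_atBot.comp h3).const_mul A
    · exact (tendsto_missMass_mixture g hP hK fun s => h2.trans_le (hs₀ s)).comp hκ

lemma ceil_le_two_mul (N : ℕ) {r : ℝ} (hr : 0 ≤ r) :
    (⌈(2 : ℝ) ^ ((N : ℝ) * r)⌉₊ : ℝ) ≤ 2 * 2 ^ ((N : ℝ) * r) := by
  have h1 := Nat.ceil_lt_add_one (a := (2 : ℝ) ^ ((N : ℝ) * r)) (by positivity)
  have h2 : 1 ≤ (2 : ℝ) ^ ((N : ℝ) * r) := Real.one_le_rpow one_le_two (by positivity)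
  linarith

/-- The incomplete last sub-block has fewer than `n` instants and costs only a constant factor. -/
lemma rpow_le_mul_exp {n : ℕ} (hn : 0 < n) (N : ℕ) {r : ℝ} (hr : 0 ≤ r) :
    (2 : ℝ) ^ ((N : ℝ) * r) ≤ 2 ^ ((n : ℝ) * r) * Real.exp (n * r * Real.log 2 * (N / n : ℕ)) := by
  have h1 : N ≤ n + n * (N / n) := by
    have := Nat.div_add_mod N n
    have := Nat.mod_lt N hn
    omega
  have h2 : (N : ℝ) ≤ n + n * (N / n : ℕ) := by exact_mod_cast h1
  have h3 : Real.exp (n * r * Real.log 2 * (N / n : ℕ)) = 2 ^ ((n : ℝ) * (N / n : ℕ) * r) := by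
    rw [Real.rpow_def_of_pos two_pos]
    ring_nf
  rw [h3, ← Real.rpow_add two_pos, ← add_mul]
  exact Real.rpow_le_rpow_of_exponent_le one_le_two (mul_le_mul_of_nonneg_right h2 hr)

lemma mul_log_lt_of_le {n : ℕ} (hn : 0 < n) {r t J : ℝ} (hr : 0 < r) (ht : t < 1)
    (h : r ≤ 1 / (n : ℝ) * (J / Real.log 2)) : n * (t * r) * Real.log 2 < J := by
  have hn' : (0 : ℝ) < n := by exact_mod_cast hn
  have hl : 0 < Real.log 2 := Real.log_pos one_lt_two
  rw [one_div_mul_eq_div, le_div_iff₀ hn', le_div_iff₀ hl] at h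
  refine lt_of_lt_of_le ?_ h
  rw [mul_comm r]
  exact mul_lt_mul_of_pos_right (mul_lt_mul_of_pos_left (by nlinarith) hn') hl

lemma achievable_smul [Fintype X₁] [Fintype X₂] (hW : ∀ x₁ x₂, W x₁ x₂ ∈ stdSimplex ℝ Y)
    (E : ℕ → Delay dmin dmax → Set (ℤ → X₁)) {n : ℕ} (hn : 0 < n) {R : ℝ × ℝ}
    (hR : R ∈ regionQ W dmin dmax n) {t : ℝ} (ht : 0 < t) (ht1 : t < 1) :
    Achievable W E (t • R) := by
  have hR' : ∃ P ∈ stdSimplex ℝ ((Fin n → X₁) × (Fin n → X₂)), ∀ d : Delay dmin dmax,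
      R ∈ ratePairs P (coreLaw W d) := by
    simpa only [regionQ, Set.mem_iUnion, Set.mem_iInter, exists_prop] using hR
  obtain ⟨P, hP, h⟩ := hR'
  have : Nonempty (Delay dmin dmax) := ⟨⟨0, by simp⟩⟩
  have hr := fun d => (ratePairs_iff hP (fun _ _ => coreLaw_mem hW d _ _) R).1 (h d)
  obtain ⟨h1, h2, -⟩ := hr (Classical.arbitrary _)
  obtain ⟨x⟩ : Nonempty ((Fin n → X₁) × (Fin n → X₂)) := by
    by_contra hempty
    rw [not_nonempty_iff] at hempty
    have := hP.2
    simp at this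
  have : Nonempty X₁ := ⟨x.1 ⟨0, hn⟩⟩
  have : Nonempty X₂ := ⟨x.2 ⟨0, hn⟩⟩
  set K : Delay dmin dmax → (Fin n → X₁) × (Fin n → X₂) → (Core dmin dmax n → Y) → ℝ :=
    fun d x => coreLaw W d x.1 x.2 with hKdef
  have hK : ∀ d x, K d x ∈ stdSimplex ℝ _ := fun d x => coreLaw_mem hW d _ _
  have hκ : Tendsto (fun N => N / n) atTop atTop := Nat.tendsto_div_const_atTop hn.ne'
  set M₁ : ℕ → ℕ := fun N => ⌈(2 : ℝ) ^ ((N : ℝ) * (t • R).1)⌉₊ with hM₁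
  set M₂ : ℕ → ℕ := fun N => ⌈(2 : ℝ) ^ ((N : ℝ) * (t • R).2)⌉₊ with hM₂
  have r1 : 0 ≤ (t • R).1 := mul_nonneg ht.le h1
  have r2 : 0 ≤ (t • R).2 := mul_nonneg ht.le h2
  obtain ⟨G₁, B₁, hB₁, hMG₁, hlim₁, hmiss₁⟩ := exists_thresholds (fun _ => ()) hP hK hκ
    (M := fun N => (M₁ N : ℝ) * M₂ N) (by
      rcases (add_nonneg h1 h2).eq_or_lt with h0 | h0
      · left
        have z1 : R.1 = 0 := by linarith
        have z2 : R.2 = 0 := by linarith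
        intro N
        simp [hM₁, hM₂, z1, z2]
      · right
        -- The factor `4` pays for the two ceilings, each at most doubling, and the power of `2` for
        -- the incomplete last sub-block.
        refine ⟨n * (t * (R.1 + R.2)) * Real.log 2, 4 * 2 ^ ((n : ℝ) * (t * (R.1 + R.2))),
          by positivity, fun d => mul_log_lt_of_le hn h0 ht1 (hr d).2.2.1, fun N => ?_⟩
        have k := rpow_le_mul_exp hn N (mul_nonneg ht.le h0.le)
        calc (M₁ N : ℝ) * M₂ N ≤ 2 * 2 ^ ((N : ℝ) * (t • R).1) * (2 * 2 ^ ((N : ℝ) * (t • R).2)) :=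
              mul_le_mul (ceil_le_two_mul N r1) (ceil_le_two_mul N r2) (by positivity)
                (by positivity)
          _ = 4 * 2 ^ ((N : ℝ) * (t * (R.1 + R.2))) := by
              rw [mul_mul_mul_comm, ← Real.rpow_add two_pos, Prod.smul_fst, Prod.smul_snd,
                smul_eq_mul, smul_eq_mul]
              ring_nf
          _ ≤ _ := by rw [mul_assoc]; gcongr)
  obtain ⟨G₂, B₂, hB₂, hMG₂, hlim₂, hmiss₂⟩ := exists_thresholds Prod.fst hP hK hκ
    (M := fun N => (M₂ N : ℝ)) (by
      rcases h2.eq_or_lt with h0 | h0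
      · left
        intro N
        simp [hM₂, ← h0]
      · right
        refine ⟨n * (t * R.2) * Real.log 2, 2 * 2 ^ ((n : ℝ) * (t * R.2)),
          by positivity, fun d => mul_log_lt_of_le hn h0 ht1 (hr d).2.2.2, fun N => ?_⟩
        have k := rpow_le_mul_exp hn N (mul_nonneg ht.le h0.le)
        refine (ceil_le_two_mul N r2).trans ?_
        rw [mul_assoc]
        exact mul_le_mul_of_nonneg_left k two_pos.le)
  obtain ⟨D, hD⟩ : ∃ D : ℝ, D = Fintype.card (Delay dmin dmax) := ⟨_, rfl⟩
  have hD0 : 0 < D := by rw [hD]; exact_mod_cast Fintype.card_pos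
  refine ⟨r1, r2, fun N => D * (missMass (powLaw P (N / n))
    (mixture fun d => powChannel (K d) (N / n)) (fun _ (_ : Fin (N / n)) => ()) (G₁ N) +
      missMass (powLaw P (N / n)) (mixture fun d => powChannel (K d) (N / n))
        (fun x j => (x j).1) (G₂ N) + (B₁ N + B₂ N)), ?_, fun N => ?_⟩
  · have := ((hmiss₁.add hmiss₂).add (hlim₁.add hlim₂)).const_mul D
    simpa using this
  · have p1 : 0 < M₁ N := ceil_pos _ _
    have p2 : 0 < M₂ N := ceil_pos _ _
    have : Nonempty (Fin (M₁ N)) := ⟨⟨0, p1⟩⟩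
    have : Nonempty (Fin (M₂ N)) := ⟨⟨0, p2⟩⟩
    have hPk := powLaw_mem hP (N / n)
    have hKk := fun d => powChannel_mem (hK d) (N / n)
    obtain ⟨e₁, e, f, he, hf⟩ := exists_superposition_code (I := Fin (M₁ N)) (J := Fin (M₂ N))
      (fun (x : Fin (N / n) → (Fin n → X₁) × (Fin n → X₂)) j => (x j).1) hPk (mixture_mem hKk)
      (hB₁ N) (hB₂ N) (by simpa using hMG₁ N) (by simpa using hMG₂ N)
    obtain ⟨c, hc⟩ := exists_code_errorProb_eq (dmin := dmin) (dmax := dmax) hW hn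
      (Nat.div_mul_le_self N n) e₁ (fun i j l => (e i j l).2) f
    refine ⟨c, fun d b _ => ?_⟩
    rw [hc]
    -- Each state's channel is at most `D` times the uniform mixture, so the code's error under any
    -- delay is at most `D` times its error for the mixture.
    have hle : 1 / ((M₁ N : ℝ) * M₂ N) * ∑ m₁, ∑ m₂, ∑ z with f z ≠ (m₁, m₂),
        ∏ j, coreLaw W d (e₁ m₁ j) (e m₁ m₂ j).2 (z j) ≤ D * (1 / ((M₁ N : ℝ) * M₂ N) *
        ∑ m₁, ∑ m₂, ∑ z with f z ≠ (m₁, m₂),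
          mixture (fun d => powChannel (K d) (N / n)) (e m₁ m₂) z) := by
      rw [mul_left_comm]
      refine mul_le_mul_of_nonneg_left ?_ (by positivity)
      simp_rw [Finset.mul_sum]
      refine Finset.sum_le_sum fun m₁ _ => Finset.sum_le_sum fun m₂ _ =>
        Finset.sum_le_sum fun z _ => ?_
      rw [mixture, ← hD, mul_div_cancel₀ _ hD0.ne', ← he m₁ m₂]
      exact Finset.single_le_sum (f := fun d => powChannel (K d) (N / n) (e m₁ m₂) z)
        (fun d _ => (hKk d _).1 z) (Finset.mem_univ d)
    refine hle.trans (mul_le_mul_of_nonneg_left ?_ hD0.le)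
    rw [missMass_of_subsingleton hPk _ _ (fun _ (_ : Fin (N / n)) => ())] at hf
    simp only [Fintype.card_fin] at hf
    refine le_trans (le_of_eq ?_) hf
    congr! 7

end Achievability

end ACMAC

open ACMAC in
theorem mainTheorem1 {X₁ X₂ Y : Type*} [Fintype X₁] [Fintype X₂] [Fintype Y]
    (W : X₁ → X₂ → Y → ℝ) (hW : ∀ x₁ x₂, W x₁ x₂ ∈ stdSimplex ℝ Y)
    (dmin dmax : ℕ)
    (E : ℕ → ACMAC.Delay dmin dmax → Set (ℤ → X₁)) (hE : ∀ n d, (E n d).Nonempty) :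
    ACMAC.capacityRegion W E
        = closure (⋃ n ≥ dmin + dmax + 1, ACMAC.regionQ W dmin dmax n) ∧
      ACMAC.capacityRegion W E
        = closure (limsup (fun n => ACMAC.regionR W E n) atTop) ∧
      ACMAC.capacityRegion W E
        = closure (liminf (fun n => ACMAC.regionR W E n) atTop) := by
  have hconv : capacityRegion W E ⊆ closure (liminf (fun n => regionR W E n) atTop) :=
    closure_minimal (fun R hR => mem_closure_of_smul fun t ht ht1 =>
      mem_liminf_iff_eventually_mem.2 (hR.eventually_smul_mem hW ht ht1)) isClosed_closure
  have hinfsup : closure (liminf (fun n => regionR W E n) atTop) ⊆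
      closure (limsup (fun n => regionR W E n) atTop) :=
    closure_mono liminf_le_limsup
  have hsupQ : closure (limsup (fun n => regionR W E n) atTop) ⊆
      closure (⋃ n ≥ dmin + dmax + 1, regionQ W dmin dmax n) :=
    closure_minimal (fun R hR => mem_closure_of_smul fun t ht ht1 => by
      simpa only [Set.mem_iUnion, exists_prop] using
        exists_smul_mem_regionQ hW hE (mem_limsup_iff_frequently_mem.1 hR) ht ht1)
      isClosed_closure
  have hQ : closure (⋃ n ≥ dmin + dmax + 1, regionQ W dmin dmax n) ⊆ capacityRegion W E := by
    refine closure_minimal (fun R hR => ?_) isClosed_closure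
    simp only [Set.mem_iUnion, exists_prop] at hR
    obtain ⟨n, hn, hR⟩ := hR
    exact mem_closure_of_smul fun t ht ht1 => achievable_smul hW E (by omega) hR ht ht1
  exact ⟨(hconv.trans (hinfsup.trans hsupQ)).antisymm hQ,
    (hconv.trans hinfsup).antisymm (hsupQ.trans hQ),
    hconv.antisymm (hinfsup.trans (hsupQ.trans hQ))⟩
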